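/- Let $C_I, C_{SI}, C_{SG} > 0$. There are constants $C, C', \gamma > 0$, depending only on $C_I, C_{SI}, C_{SG}$, such that the following holds for all natural numbers $n, m$ with $m \ge C n$. Let $\mu$ be a probability distribution on $\mathbb{C}^n$ such that a random vector $\alpha \sim \mu$ satisfies 1. (isotropy on $\mathbb{C}^n$) $\mathbb{E}\,|\langle \alpha, z\rangle|^2 = C_I \|z\|_{\ell_2}^2$ for all $z \in \mathbb{C}^n$; 2. (sub-isotropy on Hermitian matrices) $\mathbb{E}\,\langle \alpha | Z | \alpha\rangle^2 \ge C_{SI}\|Z\|_2^2$ for all Hermitian $Z \in \mathbb{C}^{n\times n}$; 3. (sub-Gaussian moments) $\mathbb{E}\,|\langle \alpha, z\rangle|^{2N} \le C_{SG}\, N!$ for all $z \in \mathbb{C}^n$ with $\|z\|_{\ell_2}=1$ and all integers $N \ge 1$, where $\|Z\|_2 = \sqrt{\operatorname{tr}(Z Z^\dagger)}$ is the Hilbert–Schmidt norm. Let $\alpha_1,\dots,\alpha_m$ be independent random vectors with law $\mu$. Then there is an event of probability at least $1 - 3e^{-\gamma m}$ on which the following holds simultaneously for every $x \in \mathbb{C}^n$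 and every noise vector $\epsilon \in \mathbb{R}^m$. With $y_k = |\langle \alpha_k, x\rangle|^2 + \epsilon_k$ for $k = 1,\dots,m$, the PhaseLift program $$\text{minimize } \sum_{k=1}^m \bigl|\operatorname{tr}\bigl(|\alpha_k\rangle\langle\alpha_k|\, Z\bigr) - y_k\bigr| \quad\text{over Hermitian } Z \in \mathbb{C}^{n\times n} \text{ with } Z \ge 0$$ has a minimizer, and every minimizer $X^\sharp$ satisfies $$\bigl\|X^\sharp - |x\rangle\langle x|\bigr\|_2 \le \frac{C'\,\|\epsilon\|_{\ell_1}}{m}.$$ -/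

import Mathlib

open MeasureTheory ProbabilityTheory
open scoped ComplexOrder

namespace PhaseLift

noncomputable section

/-- The matrix `|x⟩⟨x|`, with entries `x i * conj (x j)`. -/
def ketBra {n : ℕ} (x : EuclideanSpace ℂ (Fin n)) : Matrix (Fin n) (Fin n) ℂ :=
  Matrix.vecMulVec x.ofLp (star x.ofLp)

/-- The complex number `⟨a|Z|a⟩`. It is real when `Z` is Hermitian. -/
def quadForm {n : ℕ} (Z : Matrix (Fin n) (Fin n) ℂ) (a : EuclideanSpace ℂ (Fin n)) : ℂ :=
  star a.ofLp ⬝ᵥ Z.mulVec a.ofLp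

/-- The Hilbert-Schmidt norm `‖Z‖₂ = (tr (Z Z†))^(1/2)`. -/
def hsNorm {n : ℕ} (Z : Matrix (Fin n) (Fin n) ℂ) : ℝ :=
  √(Matrix.trace (Z * Z.conjTranspose)).re

/-- The law `μ` of a random vector of `ℂⁿ` is isotropic on `ℂⁿ` with constant `CI`, sub-isotropic
on the Hermitian matrices with constant `CSI`, and has sub-Gaussian moments with constant `CSG`.
Integrability of the moments is demanded explicitly in the last condition; the integrands of the
first two are then integrable as well. -/
structure IsEnsemble {n : ℕ} (μ : Measure (EuclideanSpace ℂ (Fin n))) (CI CSI CSG : ℝ) :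
    Prop where
  isotropic : ∀ z : EuclideanSpace ℂ (Fin n),
    ∫ a, ‖inner ℂ a z‖ ^ 2 ∂μ = CI * ‖z‖ ^ 2
  subIsotropic : ∀ Z : Matrix (Fin n) (Fin n) ℂ, Z.IsHermitian →
    CSI * hsNorm Z ^ 2 ≤ ∫ a, (quadForm Z a).re ^ 2 ∂μ
  subGaussian : ∀ z : EuclideanSpace ℂ (Fin n), ‖z‖ = 1 → ∀ N : ℕ, 1 ≤ N →
    Integrable (fun a => ‖inner ℂ a z‖ ^ (2 * N)) μ ∧
      ∫ a, ‖inner ℂ a z‖ ^ (2 * N) ∂μ ≤ CSG * (N.factorial : ℝ)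

/-- The noisy phaseless measurements `y k = |⟨α k, x⟩|² + ε k`. -/
def measurements {n m : ℕ} (α : Fin m → EuclideanSpace ℂ (Fin n))
    (x : EuclideanSpace ℂ (Fin n)) (ε : Fin m → ℝ) : Fin m → ℝ :=
  fun k => ‖inner ℂ (α k) x‖ ^ 2 + ε k

/-- The `ℓ₁`-loss `∑ₖ |tr (|α k⟩⟨α k| Z) - y k|`. -/
def loss {n m : ℕ} (α : Fin m → EuclideanSpace ℂ (Fin n)) (y : Fin m → ℝ)
    (Z : Matrix (Fin n) (Fin n) ℂ) : ℝ :=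
  ∑ k, ‖Matrix.trace (ketBra (α k) * Z) - (y k : ℂ)‖

/-- `X` is a minimizer of the PhaseLift program: minimize `loss α y Z` over `Z ≥ 0`. -/
def IsMinimizer {n m : ℕ} (α : Fin m → EuclideanSpace ℂ (Fin n)) (y : Fin m → ℝ)
    (X : Matrix (Fin n) (Fin n) ℂ) : Prop :=
  X.PosSemidef ∧ ∀ Z : Matrix (Fin n) (Fin n) ℂ, Z.PosSemidef → loss α y X ≤ loss α y Z

end

end PhaseLift

/-! On an event of overwhelming probability two deterministic facts hold. Near isotropy: the
empirical second moment in every direction `v` is within a factor `1/2` of `m * CI * ‖v‖ ^ 2`.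
Restricted lower bound: `∑ k, |⟨a k|X|a k⟩| ≥ c * m` for every Hermitian `X` with `hsNorm X = 1` and
nuclear norm at most `10`.

These suffice. Let `X = Z - |x⟩⟨x|` with `Z ≥ 0`. It has at most one negative eigenvalue, so its
negative part has trace at most `hsNorm X`. If the nuclear norm is at most `10 * hsNorm X`, the
restricted bound applies; otherwise `X` is dominated by its positive part and near isotropy alone
bounds `∑ k, ⟨a k|X|a k⟩` from below (`le_sum_abs_quadForm_sub`). Comparing the loss of a minimizer
with that of `|x⟩⟨x|`, which is `∑ k, |ε k|`, gives the error bound.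

Near isotropy follows from Chernoff bounds on a net of the sphere. For the restricted bound, the
second and fourth moments bound the mean of `min |⟨a|X|a⟩| B` below (`le_integral_min`). The uniform
deviation from this mean is handled by symmetrization and contraction, carried out directly on
exponential moments of suprema (`lintegral_supExp_centered_le`, `lintegral_pi_supExp_le`). After
contraction the process is linear in `X`, so bounded nuclear norm reduces it to a signed quadratic
form on the sphere, hence to the net. The cost is `25 ^ n`, independent of how many matrices are
compared; `m ≥ C * n` absorbs it. -/

namespace PhaseLift

open scoped ENNReal

/-! ### Suprema of exponentials over a finite family -/

/-- The supremum of `exp (g i)` over `i`, as an extended nonnegative real. -/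
noncomputable def supExp {ι : Type*} (g : ι → ℝ) : ℝ≥0∞ :=
  ⨆ i, ENNReal.ofReal (Real.exp (g i))

theorem exp_le_supExp {ι : Type*} (g : ι → ℝ) (i : ι) :
    ENNReal.ofReal (Real.exp (g i)) ≤ supExp g :=
  le_iSup (fun i => ENNReal.ofReal (Real.exp (g i))) i

theorem exists_exp_eq_supExp {ι : Type*} [Finite ι] [Nonempty ι] (g : ι → ℝ) :
    ∃ i, ENNReal.ofReal (Real.exp (g i)) = supExp g :=
  exists_eq_ciSup_of_finite

theorem measurable_supExp {ι Ω : Type*} [Countable ι] [MeasurableSpace Ω] {f : Ω → ι → ℝ}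
    (hf : ∀ i, Measurable fun a => f a i) : Measurable fun a => supExp (f a) :=
  Measurable.iSup fun i => (Real.measurable_exp.comp (hf i)).ennreal_ofReal

/-- Weak majorization of pairs is respected by sums of exponentials. -/
theorem exp_add_exp_le {x y S D : ℝ} (hx : x ≤ max S D) (hy : y ≤ max S D) (h : x + y ≤ S + D) :
    Real.exp x + Real.exp y ≤ Real.exp S + Real.exp D := by
  wlog hSD : D ≤ S generalizing S D
  · rw [add_comm (Real.exp S)]
    exact this (by rwa [max_comm]) (by rwa [max_comm]) (by linarith) (by linarith)
  wlog hxy : y ≤ x generalizing x y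
  · rw [add_comm (Real.exp x)]
    exact this hy hx (by linarith) (by linarith)
  rw [max_eq_left hSD] at hx hy
  rcases le_or_gt y D with hyD | hyD
  · exact add_le_add (Real.exp_le_exp.2 hx) (Real.exp_le_exp.2 hyD)
  -- The tangent line of `exp` at `b` lies below the graph.
  have key (a b : ℝ) : Real.exp b * (a - b) ≤ Real.exp a - Real.exp b := by
    have h1 := Real.add_one_le_exp (a - b)
    have h2 : Real.exp a = Real.exp b * Real.exp (a - b) := by
      rw [← Real.exp_add]; congr 1; ring
    rw [h2]
    nlinarith [Real.exp_pos b]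
  have h1 := key S x
  have h2 := key D y
  have h3 : Real.exp y * (y - D) ≤ Real.exp x * (S - x) :=
    mul_le_mul (Real.exp_le_exp.2 hxy) (by linarith) (by linarith) (Real.exp_pos x).le
  linarith

/-- The contraction principle for a single Rademacher sign. -/
theorem supExp_contraction {ι : Type*} [Finite ι] (g φ u : ι → ℝ) (h0 : ∀ i, |φ i| ≤ |u i|)
    (h1 : ∀ i j, |φ i - φ j| ≤ |u i - u j|) :
    supExp (fun i => g i + φ i) + supExp (fun i => g i - φ i) ≤
      supExp (fun i => g i + u i) + supExp (fun i => g i - u i) := by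
  cases isEmpty_or_nonempty ι
  · simp [supExp]
  obtain ⟨i, hi⟩ := exists_exp_eq_supExp (fun i => g i + φ i)
  obtain ⟨j, hj⟩ := exists_exp_eq_supExp (fun i => g i - φ i)
  obtain ⟨k, hk⟩ := exists_exp_eq_supExp (fun i => g i + u i)
  obtain ⟨l, hl⟩ := exists_exp_eq_supExp (fun i => g i - u i)
  have hk' (i : ι) : g i + u i ≤ g k + u k := by
    have := exp_le_supExp (fun i => g i + u i) i
    rwa [← hk, ENNReal.ofReal_le_ofReal_iff (Real.exp_pos _).le, Real.exp_le_exp] at this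
  have hl' (i : ι) : g i - u i ≤ g l - u l := by
    have := exp_le_supExp (fun i => g i - u i) i
    rwa [← hl, ENNReal.ofReal_le_ofReal_iff (Real.exp_pos _).le, Real.exp_le_exp] at this
  rw [← hi, ← hj, ← hk, ← hl, ← ENNReal.ofReal_add (Real.exp_pos _).le (Real.exp_pos _).le,
    ← ENNReal.ofReal_add (Real.exp_pos _).le (Real.exp_pos _).le]
  apply ENNReal.ofReal_le_ofReal
  have hmax (i : ι) (s : ℝ) (hs : s ≤ |u i|) : g i + s ≤ max (g k + u k) (g l - u l) := by
    rcases abs_cases (u i) with ⟨h, _⟩ | ⟨h, _⟩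
    · exact le_max_of_le_left (by linarith [hk' i])
    · exact le_max_of_le_right (by linarith [hl' i])
  refine exp_add_exp_le (hmax i _ ((le_abs_self _).trans (h0 i))) ?_ ?_
  · exact hmax j (-φ j) ((neg_le_abs _).trans (h0 j))
  · have h2 := (le_abs_self _).trans (h1 i j)
    -- The sign of `u i - u j` decides which of `i`, `j` is tested against the maximizer `k` of `g +
    -- u` and which against the maximizer `l` of `g - u`.
    rcases abs_cases (u i - u j) with ⟨h, _⟩ | ⟨h, _⟩
    · linarith [hk' i, hl' j]
    · linarith [hk' j, hl' i]

/-- Midpoint convexity of `exp` decouples `p` from `q`. In the symmetrization they are the values at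
two independent copies, and the doubling here is the usual factor `2`. -/
theorem supExp_add_sub_le {ι : Type*} (g p q : ι → ℝ) :
    supExp (fun i => g i + p i - q i) ≤
      2⁻¹ * supExp (fun i => g i + 2 * p i) + 2⁻¹ * supExp (fun i => g i - 2 * q i) := by
  refine iSup_le fun i => ?_
  have h := convexOn_exp.2 (Set.mem_univ (g i + 2 * p i)) (Set.mem_univ (g i - 2 * q i))
    (by norm_num : (0 : ℝ) ≤ 2⁻¹) (by norm_num : (0 : ℝ) ≤ 2⁻¹) (by norm_num)
  simp only [smul_eq_mul] at h
  rw [show 2⁻¹ * (g i + 2 * p i) + 2⁻¹ * (g i - 2 * q i) = g i + p i - q i by ring] at h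
  refine (ENNReal.ofReal_le_ofReal h).trans ?_
  rw [ENNReal.ofReal_add (by positivity) (by positivity), ENNReal.ofReal_mul (by norm_num),
    ENNReal.ofReal_mul (by norm_num), ENNReal.ofReal_inv_of_pos (by norm_num), ENNReal.ofReal_ofNat]
  gcongr
  · exact exp_le_supExp (fun i => g i + 2 * p i) i
  · exact exp_le_supExp (fun i => g i - 2 * q i) i

/-- The uniform distribution on the signs `1` and `-1`. -/
noncomputable def signMeasure : Measure ℝ :=
  (2⁻¹ : ℝ≥0∞) • Measure.dirac 1 + (2⁻¹ : ℝ≥0∞) • Measure.dirac (-1)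

instance : IsProbabilityMeasure signMeasure :=
  ⟨by simp [signMeasure, ENNReal.inv_two_add_inv_two]⟩

theorem lintegral_prod_signMeasure {E : Type*} [MeasurableSpace E] (μ : Measure E) [SFinite μ]
    {F : E × ℝ → ℝ≥0∞} (hF : Measurable F) :
    ∫⁻ b, F b ∂(μ.prod signMeasure) = ∫⁻ a, (2⁻¹ * F (a, 1) + 2⁻¹ * F (a, -1)) ∂μ := by
  rw [lintegral_prod _ hF.aemeasurable]
  refine lintegral_congr fun a => ?_
  simp [signMeasure, lintegral_add_measure, lintegral_smul_measure]

/-- Jensen's inequality for the exponential of a bounded function. -/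
theorem exp_integral_le_lintegral {E : Type*} [MeasurableSpace E] (μ : Measure E)
    [IsProbabilityMeasure μ] {f : E → ℝ} (hf : Measurable f) {B : ℝ} (hB : ∀ a, |f a| ≤ B) (c : ℝ) :
    ENNReal.ofReal (Real.exp (c + ∫ a, f a ∂μ)) ≤
      ∫⁻ a, ENNReal.ofReal (Real.exp (c + f a)) ∂μ := by
  have hfi : Integrable f μ := .of_bound hf.aestronglyMeasurable B (.of_forall hB)
  have hei : Integrable (fun a => Real.exp (c + f a)) μ := by
    refine .of_bound (by fun_prop) (Real.exp (c + B)) (.of_forall fun a => ?_)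
    rw [Real.norm_eq_abs, abs_of_pos (Real.exp_pos _)]
    exact Real.exp_le_exp.2 (by linarith [(abs_le.1 (hB a)).2])
  rw [← ofReal_integral_eq_lintegral_ofReal hei (.of_forall fun a => (Real.exp_pos _).le)]
  apply ENNReal.ofReal_le_ofReal
  have := convexOn_exp.map_integral_le (μ := μ) (f := fun a => c + f a)
    Real.continuous_exp.continuousOn isClosed_univ (.of_forall fun a => Set.mem_univ _)
    ((integrable_const c).add hfi) hei
  rwa [integral_add (integrable_const c) hfi, integral_const, probReal_univ, one_smul] at this

/-- Symmetrization and contraction in one variable. -/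
theorem lintegral_supExp_centered_le {E ι : Type*} [MeasurableSpace E] [Finite ι] (μ : Measure E)
    [IsProbabilityMeasure μ] {f u : ι → E → ℝ} (hf : ∀ i, Measurable (f i))
    (hu : ∀ i, Measurable (u i)) {B : ℝ} (hB : ∀ i a, |f i a| ≤ B)
    (h0 : ∀ i a, |f i a| ≤ |u i a|) (h1 : ∀ i j a, |f i a - f j a| ≤ |u i a - u j a|) (g : ι → ℝ) :
    ∫⁻ a, supExp (fun i => g i + ((∫ a', f i a' ∂μ) - f i a)) ∂μ ≤
      ∫⁻ b, supExp (fun i => g i + b.2 * (2 * u i b.1)) ∂(μ.prod signMeasure) := by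
  have hm1 : Measurable fun a => 2⁻¹ * supExp (fun i => g i + 2 * f i a) :=
    (measurable_supExp fun i => by have := hf i; fun_prop).const_mul _
  have hm2 : Measurable fun a => 2⁻¹ * supExp (fun i => g i - 2 * f i a) :=
    (measurable_supExp fun i => by have := hf i; fun_prop).const_mul _
  calc ∫⁻ a, supExp (fun i => g i + ((∫ a', f i a' ∂μ) - f i a)) ∂μ
      ≤ ∫⁻ a, ∫⁻ a', supExp (fun i => g i + f i a' - f i a) ∂μ ∂μ := by
        refine lintegral_mono fun a => iSup_le fun i => ?_
        beta_reduce
        rw [show g i + ((∫ a', f i a' ∂μ) - f i a) = (g i - f i a) + ∫ a', f i a' ∂μ by ring]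
        refine (exp_integral_le_lintegral μ (hf i) (hB i) _).trans (lintegral_mono fun a' => ?_)
        rw [show g i - f i a + f i a' = g i + f i a' - f i a by ring]
        exact exp_le_supExp (fun i => g i + f i a' - f i a) i
    _ ≤ ∫⁻ a, ∫⁻ a', (2⁻¹ * supExp (fun i => g i + 2 * f i a') +
          2⁻¹ * supExp (fun i => g i - 2 * f i a)) ∂μ ∂μ :=
        lintegral_mono fun a => lintegral_mono fun a' => supExp_add_sub_le _ _ _
    _ = ∫⁻ a, (2⁻¹ * supExp (fun i => g i + 2 * f i a) +
          2⁻¹ * supExp (fun i => g i - 2 * f i a)) ∂μ := by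
        simp_rw [lintegral_add_left hm1]
        simp [lintegral_add_left]
    _ ≤ ∫⁻ a, (2⁻¹ * supExp (fun i => g i + 1 * (2 * u i a)) +
          2⁻¹ * supExp (fun i => g i + (-1) * (2 * u i a))) ∂μ := by
        refine lintegral_mono fun a => ?_
        simp only [← mul_add]
        gcongr 2⁻¹ * ?_
        simp only [one_mul, neg_one_mul, ← sub_eq_add_neg]
        exact supExp_contraction g (fun i => 2 * f i a) (fun i => 2 * u i a)
          (fun i => by simpa [abs_mul] using h0 i a)
          (fun i j => by simpa [abs_mul, ← mul_sub] using h1 i j a)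
    _ = _ := by
        rw [lintegral_prod_signMeasure]
        exact measurable_supExp fun i => by have := hu i; fun_prop

/-- Comparisons of exponential suprema tensorize. -/
theorem lintegral_pi_supExp_le {E E' : Type*} {ι : Type*} [MeasurableSpace E] [MeasurableSpace E']
    [Countable ι] (μ : Measure E) (ν : Measure E') [IsProbabilityMeasure μ] [IsProbabilityMeasure ν]
    {h : ι → E → ℝ} {w : ι → E' → ℝ} (hh : ∀ i, Measurable (h i)) (hw : ∀ i, Measurable (w i))
    (H : ∀ g : ι → ℝ, ∫⁻ a, supExp (fun i => g i + h i a) ∂μ ≤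
      ∫⁻ b, supExp (fun i => g i + w i b) ∂ν) (m : ℕ) (g : ι → ℝ) :
    ∫⁻ a, supExp (fun i => g i + ∑ k, h i (a k)) ∂(Measure.pi fun _ : Fin m => μ) ≤
      ∫⁻ b, supExp (fun i => g i + ∑ k, w i (b k)) ∂(Measure.pi fun _ : Fin m => ν) := by
  induction m generalizing g with
  | zero => simp
  | succ m ih =>
    have hE := ((measurePreserving_piFinSuccAbove (fun _ : Fin (m + 1) => μ) 0).symm).lintegral_comp_emb
      (MeasurableEquiv.measurableEmbedding _) (fun a => supExp (fun i => g i + ∑ k, h i (a k)))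
    have hE' := ((measurePreserving_piFinSuccAbove (fun _ : Fin (m + 1) => ν) 0).symm).lintegral_comp_emb
      (MeasurableEquiv.measurableEmbedding _) (fun a => supExp (fun i => g i + ∑ k, w i (a k)))
    rw [← hE, ← hE']
    simp only [MeasurableEquiv.piFinSuccAbove_symm_apply, Fin.insertNthEquiv_zero,
      Fin.consEquiv_apply, Fin.sum_univ_succ, Fin.cons_zero, Fin.cons_succ]
    rw [lintegral_prod _ (measurable_supExp fun i => by
        have := hh i; fun_prop).aemeasurable,
      lintegral_prod_symm _ (measurable_supExp fun i => by
        have := hw i; fun_prop).aemeasurable]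
    -- The arbitrary offset `g` absorbs whatever is held fixed: first the head coordinate, for the
    -- induction hypothesis, then, after Tonelli, the replaced tail, for `H`.
    calc _ ≤ ∫⁻ x, ∫⁻ b, supExp (fun i => (g i + h i x) + ∑ k, w i (b k))
            ∂(Measure.pi fun _ : Fin m => ν) ∂μ := by
          refine lintegral_mono fun x => ?_
          simpa only [add_assoc] using ih fun i => g i + h i x
      _ = ∫⁻ b, ∫⁻ x, supExp (fun i => (g i + h i x) + ∑ k, w i (b k)) ∂μ
            ∂(Measure.pi fun _ : Fin m => ν) := by
          apply lintegral_lintegral_swap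
          exact (measurable_supExp fun i => by have := hw i; have := hh i; fun_prop).aemeasurable
      _ ≤ _ := by
          refine lintegral_mono fun b => ?_
          simpa only [add_right_comm, ← add_assoc] using H fun i => g i + ∑ k, w i (b k)

/-- The exponential moment of a sum of independent copies is at most the product. -/
theorem lintegral_pi_exp_sum_le {E : Type*} [MeasurableSpace E] (μ : Measure E)
    [IsProbabilityMeasure μ] {h : E → ℝ} (hh : Measurable h) {c : ℝ}
    (H : ∫⁻ a, ENNReal.ofReal (Real.exp (h a)) ∂μ ≤ ENNReal.ofReal (Real.exp c)) (m : ℕ) :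
    ∫⁻ a, ENNReal.ofReal (Real.exp (∑ k, h (a k))) ∂(Measure.pi fun _ : Fin m => μ) ≤
      ENNReal.ofReal (Real.exp (m * c)) := by
  have := lintegral_pi_supExp_le (ι := Unit) μ (Measure.dirac ()) (h := fun _ => h)
    (w := fun _ _ => c) (fun _ => hh) (fun _ => measurable_const) (fun g => ?_) m 0
  · simpa [supExp] using this
  · simp only [supExp, ciSup_unique, lintegral_dirac, Real.exp_add,
      ENNReal.ofReal_mul (Real.exp_pos _).le]
    rw [lintegral_const_mul _ (by fun_prop)]
    gcongr

/-! ### Nets of the unit sphere and quadratic functions -/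

/-- The unit sphere of `ℂⁿ` has a `1/2`-net of at most `25 ^ n` points. -/
theorem exists_sphere_net (n : ℕ) : ∃ N : Finset (EuclideanSpace ℂ (Fin n)),
    N.card ≤ 25 ^ n ∧ (∀ v ∈ N, ‖v‖ = 1) ∧ ∀ x, ‖x‖ = 1 → ∃ v ∈ N, ‖x - v‖ < 1 / 2 := by
  classical
  let sep (s : Finset (EuclideanSpace ℂ (Fin n))) : Prop :=
    (∀ v ∈ s, ‖v‖ = 1) ∧ ∀ c ∈ s, ∀ d ∈ s, c ≠ d → 1 / 2 ≤ ‖c - d‖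
  have hcard (s) (hs : sep s) : s.card ≤ 25 ^ n := by
    -- Doubling gives norm `2` and separation `1`, the normalization of the Besicovitch bound `5 ^
    -- d`; here `d = 2 * n` over `ℝ`.
    have h2 (v : EuclideanSpace ℂ (Fin n)) : ‖(2 : ℝ) • v‖ = 2 * ‖v‖ := by
      rw [norm_smul, Real.norm_ofNat]
    have hinj : Function.Injective fun v : EuclideanSpace ℂ (Fin n) => (2 : ℝ) • v :=
      smul_right_injective _ two_ne_zero
    have := Besicovitch.card_le_of_separated (s.image fun v => (2 : ℝ) • v) ?_ ?_
    · rwa [Finset.card_image_of_injective _ hinj, finrank_real_of_complex,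
        finrank_euclideanSpace_fin, pow_mul] at this
    · simp only [Finset.mem_image, forall_exists_index, and_imp, forall_apply_eq_imp_iff₂]
      intro v hv
      rw [h2, hs.1 v hv]
      norm_num
    · simp only [Finset.mem_image, forall_exists_index, and_imp, forall_apply_eq_imp_iff₂]
      intro c hc d hd hcd
      rw [← smul_sub, h2]
      linarith [hs.2 c hc d hd fun h => hcd (by rw [h])]
  -- A separated set of maximal cardinality is a net, since an uncovered point could be added to it.
  let P (k : ℕ) : Prop := ∃ s, sep s ∧ s.card = k
  obtain ⟨s, hs, hsc⟩ : P (Nat.findGreatest P (25 ^ n)) :=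
    Nat.findGreatest_spec (m := 0) (Nat.zero_le _) ⟨∅, by simp [sep], rfl⟩
  refine ⟨s, hcard s hs, hs.1, fun x hx => ?_⟩
  by_contra! hfar
  have hxs : x ∉ s := fun h => by
    have := hfar x h
    norm_num at this
  have hsep : sep (insert x s) := by
    refine ⟨fun v hv => ?_, fun c hc d hd hcd => ?_⟩
    · rcases Finset.mem_insert.1 hv with rfl | hv
      exacts [hx, hs.1 v hv]
    · rcases Finset.mem_insert.1 hc with h | hc' <;> rcases Finset.mem_insert.1 hd with h' | hd'
      · exact absurd (h.trans h'.symm) hcd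
      · exact h ▸ hfar d hd'
      · rw [norm_sub_rev]
        exact h' ▸ hfar c hc'
      · exact hs.2 c hc' d hd' hcd
  have hle := Nat.le_findGreatest (P := P) (hcard _ hsep) ⟨_, hsep, rfl⟩
  rw [Finset.card_insert_of_notMem hxs] at hle
  omega

/-- Real quadratic functions, through homogeneity and a rescaled polarization identity. -/
structure IsQuadraticFun {E : Type*} [AddCommGroup E] [Module ℂ E] (Q : E → ℝ) : Prop where
  smul : ∀ (r : ℝ) x, Q ((r : ℂ) • x) = r ^ 2 * Q x
  polar : ∀ x v, Q ((2⁻¹ : ℂ) • (x + v) + (2 : ℂ) • (x - v)) -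
    Q ((2⁻¹ : ℂ) • (x + v) - (2 : ℂ) • (x - v)) = 4 * (Q x - Q v)

namespace IsQuadraticFun

variable {E : Type*} [NormedAddCommGroup E] [InnerProductSpace ℂ E]

theorem norm_sq : IsQuadraticFun fun x : E => ‖x‖ ^ 2 where
  smul r x := by simp [norm_smul, mul_pow]
  polar x v := by
    have h : inner ℂ ((2⁻¹ : ℂ) • (x + v)) ((2 : ℂ) • (x - v)) = inner ℂ (x + v) (x - v) := by
      rw [inner_smul_left, inner_smul_right, ← mul_assoc, map_inv₀, map_ofNat,
        inv_mul_cancel₀ two_ne_zero, one_mul]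
    rw [@norm_add_sq ℂ, @norm_sub_sq ℂ, h, inner_add_left, inner_sub_right, inner_sub_right]
    have h1 : RCLike.re (inner ℂ x x) = ‖x‖ ^ 2 := inner_self_eq_norm_sq x
    have h2 : RCLike.re (inner ℂ v v) = ‖v‖ ^ 2 := inner_self_eq_norm_sq v
    have h3 : RCLike.re (inner ℂ x v) = RCLike.re (inner ℂ v x) := inner_re_symm x v
    rw [map_add, map_sub, map_sub]
    linarith

theorem comp {F : Type*} [AddCommGroup F] [Module ℂ F] {Q : F → ℝ} (hQ : IsQuadraticFun Q)
    (L : E →ₗ[ℂ] F) : IsQuadraticFun fun x => Q (L x) where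
  smul r x := by simpa using hQ.smul r (L x)
  polar x v := by simpa using hQ.polar (L x) (L v)

theorem const_mul {Q : E → ℝ} (hQ : IsQuadraticFun Q) (c : ℝ) :
    IsQuadraticFun fun x => c * Q x where
  smul r x := by rw [hQ.smul]; ring
  polar x v := by linear_combination c * hQ.polar x v

theorem add {Q R : E → ℝ} (hQ : IsQuadraticFun Q) (hR : IsQuadraticFun R) :
    IsQuadraticFun fun x => Q x + R x where
  smul r x := by rw [hQ.smul, hR.smul]; ring
  polar x v := by linear_combination hQ.polar x v + hR.polar x v

theorem sum {ι : Type*} (s : Finset ι) {Q : ι → E → ℝ} (hQ : ∀ i, IsQuadraticFun (Q i)) :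
    IsQuadraticFun fun x => ∑ i ∈ s, Q i x where
  smul r x := by simp only [(hQ _).smul, Finset.mul_sum]
  polar x v := by
    rw [← Finset.sum_sub_distrib, ← Finset.sum_sub_distrib, Finset.mul_sum]
    exact Finset.sum_congr rfl fun i _ => (hQ i).polar x v

/-- A weighted sum of `‖⟨a k, x⟩‖²`, shifted by a multiple of `‖x‖²`. -/
theorem weighted {m : ℕ} (a : Fin m → E) (c : Fin m → ℝ) (d : ℝ) :
    IsQuadraticFun fun x => (∑ k, c k * ‖inner ℂ (a k) x‖ ^ 2) + d * ‖x‖ ^ 2 :=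
  (sum _ fun k => ((norm_sq (E := ℂ)).comp (innerₛₗ ℂ (a k))).const_mul (c k)).add
    (norm_sq.const_mul d)

theorem abs_le_mul_norm_sq {Q : E → ℝ} (hQ : IsQuadraticFun Q) {S : ℝ}
    (hS : ∀ x, ‖x‖ = 1 → |Q x| ≤ S) (x : E) : |Q x| ≤ S * ‖x‖ ^ 2 := by
  rcases eq_or_ne x 0 with rfl | hx
  · have := hQ.smul 0 0
    rw [smul_zero, zero_pow two_ne_zero, zero_mul] at this
    rw [this, norm_zero, abs_zero, zero_pow two_ne_zero, mul_zero]
  · have hx' : ‖x‖ ≠ 0 := norm_ne_zero_iff.2 hx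
    have h1 : ‖((‖x‖⁻¹ : ℝ) : ℂ) • x‖ = 1 := by
      rw [norm_smul, Complex.norm_real, Real.norm_eq_abs, abs_of_nonneg (by positivity),
        inv_mul_cancel₀ hx']
    have h2 := hS _ h1
    rw [hQ.smul, abs_mul, abs_of_nonneg (by positivity), inv_pow, inv_mul_le_iff₀ (by positivity)]
      at h2
    linarith

/-- A quadratic function is controlled by its values on a `1/2`-net of the sphere. -/
theorem abs_le_of_net {Q : E → ℝ} (hQ : IsQuadraticFun Q) {N : Finset E}
    (hN1 : ∀ v ∈ N, ‖v‖ = 1) (hN : ∀ x, ‖x‖ = 1 → ∃ v ∈ N, ‖x - v‖ < 1 / 2) {M K : ℝ}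
    (hM : ∀ v ∈ N, |Q v| ≤ M) (hK : ∀ x, ‖x‖ = 1 → |Q x| ≤ K) (x : E) :
    |Q x| ≤ 32 * M * ‖x‖ ^ 2 := by
  refine hQ.abs_le_mul_norm_sq (fun x hx => ?_) x
  -- The weights `1/2` and `2` in the polarization favour the small vector `x - v`: the two squared
  -- norms sum to `2 + 15/2 * ‖x - v‖ ^ 2 ≤ 31/8`, so the factor is `31/32 < 1`. Unweighted
  -- polarization would give `2`. Solving `S ≤ M + 31/32 * S` yields `32 * M`.
  have step (S : ℝ) (hS : ∀ x, ‖x‖ = 1 → |Q x| ≤ S) (x : E) (hx : ‖x‖ = 1) :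
      |Q x| ≤ M + 31 / 32 * S := by
    have hS0 : 0 ≤ S := (abs_nonneg _).trans (hS x hx)
    obtain ⟨v, hv, hxv⟩ := hN x hx
    have hv1 := hN1 v hv
    have h1 := hQ.abs_le_mul_norm_sq hS ((2⁻¹ : ℂ) • (x + v) + (2 : ℂ) • (x - v))
    have h2 := hQ.abs_le_mul_norm_sq hS ((2⁻¹ : ℂ) • (x + v) - (2 : ℂ) • (x - v))
    have h3 := hQ.polar x v
    have h4 := parallelogram_law_with_norm ℂ ((2⁻¹ : ℂ) • (x + v)) ((2 : ℂ) • (x - v))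
    have h5 := parallelogram_law_with_norm ℂ x v
    simp only [norm_smul, norm_inv, Complex.norm_ofNat, hx, hv1] at h4 h5
    have h6 : ‖x - v‖ ^ 2 ≤ 1 / 4 := by nlinarith [norm_nonneg (x - v)]
    have h7 : |Q x - Q v| ≤ 31 / 32 * S := by
      have : 4 * |Q x - Q v| ≤ 4 * (31 / 32 * S) := by
        calc 4 * |Q x - Q v| = |4 * (Q x - Q v)| := by rw [abs_mul]; norm_num
          _ ≤ S * ‖(2⁻¹ : ℂ) • (x + v) + (2 : ℂ) • (x - v)‖ ^ 2 +
              S * ‖(2⁻¹ : ℂ) • (x + v) - (2 : ℂ) • (x - v)‖ ^ 2 := by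
            rw [← h3]
            exact (abs_sub _ _).trans (add_le_add h1 h2)
          _ = S * (2 + 15 / 2 * ‖x - v‖ ^ 2) := by linear_combination S * h4 + S / 2 * h5
          _ ≤ S * (2 + 15 / 2 * (1 / 4)) := by gcongr
          _ = _ := by ring
      linarith
    have h8 := abs_sub_abs_le_abs_sub (Q x) (Q v)
    linarith [hM v hv]
  have hne : {r | ∃ x, ‖x‖ = 1 ∧ |Q x| = r}.Nonempty := ⟨_, x, hx, rfl⟩
  -- `K` only makes the supremum finite; it does not enter the bound.
  have hbdd : BddAbove {r | ∃ x, ‖x‖ = 1 ∧ |Q x| = r} :=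
    ⟨K, by rintro _ ⟨x, hx, rfl⟩; exact hK x hx⟩
  have hsup (x : E) (hx : ‖x‖ = 1) : |Q x| ≤ sSup {r | ∃ x, ‖x‖ = 1 ∧ |Q x| = r} :=
    le_csSup hbdd ⟨x, hx, rfl⟩
  have := csSup_le hne (by rintro _ ⟨x, hx, rfl⟩; exact step _ hsup x hx)
  linarith [hsup x hx]

end IsQuadraticFun

/-- Weighted sums of `‖⟨a k, x⟩‖²` are controlled by their values on a net of the sphere. -/
theorem abs_weighted_le_of_net {E : Type*} [NormedAddCommGroup E] [InnerProductSpace ℂ E]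
    {N : Finset E} (hN1 : ∀ v ∈ N, ‖v‖ = 1) (hN : ∀ x, ‖x‖ = 1 → ∃ v ∈ N, ‖x - v‖ < 1 / 2)
    {m : ℕ} (a : Fin m → E) (c : Fin m → ℝ) (d : ℝ) {M : ℝ}
    (hM : ∀ v ∈ N, |(∑ k, c k * ‖inner ℂ (a k) v‖ ^ 2) + d| ≤ M) (x : E) :
    |(∑ k, c k * ‖inner ℂ (a k) x‖ ^ 2) + d * ‖x‖ ^ 2| ≤ 32 * M * ‖x‖ ^ 2 := by
  refine (IsQuadraticFun.weighted a c d).abs_le_of_net hN1 hN (M := M)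
    (K := (∑ k, |c k| * ‖a k‖ ^ 2) + |d|) (fun v hv => ?_) (fun v hv => ?_) x
  · simpa [hN1 v hv] using hM v hv
  · simp only [hv, one_pow, mul_one]
    refine (abs_add_le _ _).trans (add_le_add_left ((Finset.abs_sum_le_sum_abs _ _).trans ?_) _)
    refine Finset.sum_le_sum fun k _ => ?_
    rw [abs_mul, abs_of_nonneg (sq_nonneg ‖_‖)]
    gcongr
    simpa [hv] using norm_inner_le_norm (𝕜 := ℂ) (a k) v

/-! ### Moments of an ensemble -/

/-- Multiply by `exp x ≥ 1 + x + x ^ 2 / 2` and use `(1 - x + x ^ 2 / 2) * (1 + x + x ^ 2 / 2) = 1 +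
x ^ 4 / 4`. -/
theorem exp_neg_le_quadratic {x : ℝ} (hx : 0 ≤ x) : Real.exp (-x) ≤ 1 - x + x ^ 2 / 2 := by
  have h1 := Real.quadratic_le_exp_of_nonneg hx
  have h2 : Real.exp (-x) * Real.exp x = 1 := by rw [← Real.exp_add]; simp
  have h3 : 0 < 1 - x + x ^ 2 / 2 := by nlinarith [sq_nonneg (x - 1)]
  have h4 : Real.exp (-x) * (1 + x + x ^ 2 / 2) ≤ 1 := by
    refine le_of_le_of_eq ?_ h2
    exact mul_le_mul_of_nonneg_left h1 (Real.exp_pos _).le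
  have h5 : 0 < 1 + x + x ^ 2 / 2 := by positivity
  have h6 : Real.exp (-x) * (1 + x + x ^ 2 / 2) ≤
      (1 - x + x ^ 2 / 2) * (1 + x + x ^ 2 / 2) := by
    nlinarith [sq_nonneg (x ^ 2)]
  exact le_of_mul_le_mul_right h6 h5

namespace IsEnsemble

variable {n : ℕ} {μ : Measure (EuclideanSpace ℂ (Fin n))} {CI CSI CSG : ℝ}

theorem integrable_pow (hμ : IsEnsemble μ CI CSI CSG) {z : EuclideanSpace ℂ (Fin n)}
    (hz : ‖z‖ = 1) {N : ℕ} (hN : 1 ≤ N) :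
    Integrable (fun a => (‖inner ℂ a z‖ ^ 2) ^ N) μ := by
  simpa only [← pow_mul] using (hμ.subGaussian z hz N hN).1

theorem integral_pow_le (hμ : IsEnsemble μ CI CSI CSG) {z : EuclideanSpace ℂ (Fin n)}
    (hz : ‖z‖ = 1) {N : ℕ} (hN : 1 ≤ N) :
    ∫ a, (‖inner ℂ a z‖ ^ 2) ^ N ∂μ ≤ CSG * (N.factorial : ℝ) := by
  simpa only [← pow_mul] using (hμ.subGaussian z hz N hN).2

/-- The `N!` of the moment bound cancels the one in the exponential series, leaving a geometric
tail. The linear term is kept exact, by isotropy, so that centring or a random sign can cancel it.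
-/
theorem lintegral_exp_le [IsProbabilityMeasure μ] (hμ : IsEnsemble μ CI CSI CSG) (hCSG : 0 < CSG)
    (hCI : 0 < CI)
    {z : EuclideanSpace ℂ (Fin n)} (hz : ‖z‖ = 1) {t : ℝ} (ht0 : 0 ≤ t) (ht : t ≤ 1 / 2) :
    ∫⁻ a, ENNReal.ofReal (Real.exp (t * ‖inner ℂ a z‖ ^ 2)) ∂μ ≤
      ENNReal.ofReal (1 + t * CI + 2 * CSG * t ^ 2) := by
  let b : ℕ → ℝ
    | 0 => 1
    | 1 => t * CI
    | (N + 2) => CSG * t ^ 2 * t ^ N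
  have hb0 (N : ℕ) : 0 ≤ b N := by
    match N with
    | 0 => exact zero_le_one
    | 1 => exact mul_nonneg ht0 hCI.le
    | (N + 2) => simp only [b]; positivity
  have hb : HasSum b (1 + t * CI + CSG * t ^ 2 * (1 - t)⁻¹) := by
    have h1 : HasSum (fun N => b (N + 2)) (CSG * t ^ 2 * (1 - t)⁻¹) :=
      (hasSum_geometric_of_lt_one ht0 (by linarith)).mul_left _
    have := (hasSum_nat_add_iff 2).1 h1
    simpa [Finset.sum_range_succ, b, add_comm, add_left_comm] using this
  have hterm (N : ℕ) : ∫⁻ a, ENNReal.ofReal ((t * ‖inner ℂ a z‖ ^ 2) ^ N / N.factorial) ∂μ ≤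
      ENNReal.ofReal (b N) := by
    rcases Nat.eq_zero_or_pos N with rfl | hN
    · simp [b]
    have hint := hμ.integrable_pow hz hN
    have heq (a : EuclideanSpace ℂ (Fin n)) : (t * ‖inner ℂ a z‖ ^ 2) ^ N / N.factorial =
        t ^ N / N.factorial * (‖inner ℂ a z‖ ^ 2) ^ N := by rw [mul_pow]; ring
    simp only [heq]
    rw [← ofReal_integral_eq_lintegral_ofReal (hint.const_mul _)
      (.of_forall fun a => by positivity), integral_const_mul]
    apply ENNReal.ofReal_le_ofReal
    have hle := hμ.integral_pow_le hz hN
    match N, hN with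
    | 1, _ =>
      have := hμ.isotropic z
      simp only [hz, one_pow, mul_one] at this
      simp [this, b]
    | (N + 2), _ =>
      calc _ ≤ t ^ (N + 2) / (N + 2).factorial * (CSG * (N + 2).factorial) := by gcongr
        _ = _ := by
          simp only [b]
          field_simp
          ring
  have hexp (x : ℝ) (hx : 0 ≤ x) : ENNReal.ofReal (Real.exp x) =
      ∑' N : ℕ, ENNReal.ofReal (x ^ N / N.factorial) := by
    have h := NormedSpace.expSeries_div_hasSum_exp (𝔸 := ℝ) x
    rw [← Real.exp_eq_exp_ℝ] at h
    rw [← ENNReal.ofReal_tsum_of_nonneg (fun N => by positivity) h.summable, h.tsum_eq]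
  calc ∫⁻ a, ENNReal.ofReal (Real.exp (t * ‖inner ℂ a z‖ ^ 2)) ∂μ
      = ∫⁻ a, ∑' N : ℕ, ENNReal.ofReal ((t * ‖inner ℂ a z‖ ^ 2) ^ N / N.factorial) ∂μ :=
        lintegral_congr fun a => hexp _ (by positivity)
    _ = ∑' N : ℕ, ∫⁻ a, ENNReal.ofReal ((t * ‖inner ℂ a z‖ ^ 2) ^ N / N.factorial) ∂μ :=
        lintegral_tsum fun N => by fun_prop
    _ ≤ ∑' N : ℕ, ENNReal.ofReal (b N) := ENNReal.tsum_le_tsum hterm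
    _ = ENNReal.ofReal (1 + t * CI + CSG * t ^ 2 * (1 - t)⁻¹) := by
        rw [← ENNReal.ofReal_tsum_of_nonneg hb0 hb.summable, hb.tsum_eq]
    _ ≤ _ := by
        apply ENNReal.ofReal_le_ofReal
        have : (1 - t)⁻¹ ≤ 2 := by
          rw [inv_le_comm₀ (by linarith) (by norm_num)]
          linarith
        nlinarith [mul_nonneg hCSG.le (sq_nonneg t)]

theorem lintegral_exp_neg_le [IsProbabilityMeasure μ] (hμ : IsEnsemble μ CI CSI CSG)
    {z : EuclideanSpace ℂ (Fin n)} (hz : ‖z‖ = 1) {t : ℝ} (ht0 : 0 ≤ t) :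
    ∫⁻ a, ENNReal.ofReal (Real.exp (-(t * ‖inner ℂ a z‖ ^ 2))) ∂μ ≤
      ENNReal.ofReal (1 - t * CI + CSG * t ^ 2) := by
  have h1 : Integrable (fun a => ‖inner ℂ a z‖ ^ 2) μ := by
    simpa using hμ.integrable_pow hz le_rfl
  have h2 := hμ.integrable_pow hz one_le_two
  have h3 : Integrable (fun a => 1 - t * ‖inner ℂ a z‖ ^ 2) μ :=
    (integrable_const 1).sub (h1.const_mul t)
  have hint : Integrable (fun a => 1 - t * ‖inner ℂ a z‖ ^ 2 +
      t ^ 2 / 2 * (‖inner ℂ a z‖ ^ 2) ^ 2) μ :=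
    h3.add (h2.const_mul _)
  have hpt (a : EuclideanSpace ℂ (Fin n)) : Real.exp (-(t * ‖inner ℂ a z‖ ^ 2)) ≤
      1 - t * ‖inner ℂ a z‖ ^ 2 + t ^ 2 / 2 * (‖inner ℂ a z‖ ^ 2) ^ 2 := by
    refine (exp_neg_le_quadratic (by positivity)).trans (le_of_eq (by ring))
  refine (lintegral_mono fun a => ENNReal.ofReal_le_ofReal (hpt a)).trans ?_
  rw [← ofReal_integral_eq_lintegral_ofReal hint
    (.of_forall fun a => (Real.exp_pos _).le.trans (hpt a))]
  apply ENNReal.ofReal_le_ofReal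
  rw [integral_add h3 (h2.const_mul _),
    integral_sub (integrable_const 1) (h1.const_mul t), integral_const_mul, integral_const_mul,
    hμ.isotropic z, hz]
  have h4 := hμ.integral_pow_le hz one_le_two
  simp only [integral_const, probReal_univ, smul_eq_mul, Nat.factorial_two, Nat.cast_ofNat] at h4 ⊢
  nlinarith [mul_le_mul_of_nonneg_left h4 (sq_nonneg t)]

theorem lintegral_exp_centered_le [IsProbabilityMeasure μ] (hμ : IsEnsemble μ CI CSI CSG)
    (hCSG : 0 < CSG) (hCI : 0 < CI)
    {z : EuclideanSpace ℂ (Fin n)} (hz : ‖z‖ = 1) {t : ℝ} (ht : |t| ≤ 1 / 2) :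
    ∫⁻ a, ENNReal.ofReal (Real.exp (t * (‖inner ℂ a z‖ ^ 2 - CI))) ∂μ ≤
      ENNReal.ofReal (Real.exp (2 * CSG * t ^ 2)) := by
  have hsplit (a : EuclideanSpace ℂ (Fin n)) :
      ENNReal.ofReal (Real.exp (t * (‖inner ℂ a z‖ ^ 2 - CI))) =
      ENNReal.ofReal (Real.exp (-(t * CI))) *
        ENNReal.ofReal (Real.exp (t * ‖inner ℂ a z‖ ^ 2)) := by
    rw [← ENNReal.ofReal_mul (Real.exp_pos _).le, ← Real.exp_add]
    congr 2; ring
  have hmain : ∫⁻ a, ENNReal.ofReal (Real.exp (t * ‖inner ℂ a z‖ ^ 2)) ∂μ ≤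
      ENNReal.ofReal (1 + t * CI + 2 * CSG * t ^ 2) := by
    rcases le_total 0 t with h | h
    · exact hμ.lintegral_exp_le hCSG hCI hz h ((le_abs_self t).trans ht)
    · have := hμ.lintegral_exp_neg_le hz (neg_nonneg.2 h)
      simp only [neg_mul, neg_neg, sub_neg_eq_add, even_two.neg_pow] at this
      refine this.trans (ENNReal.ofReal_le_ofReal ?_)
      nlinarith [mul_nonneg hCSG.le (sq_nonneg t)]
  simp only [hsplit]
  rw [lintegral_const_mul _ (by fun_prop)]
  calc _ ≤ ENNReal.ofReal (Real.exp (-(t * CI))) *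
        ENNReal.ofReal (Real.exp (t * CI + 2 * CSG * t ^ 2)) := by
        gcongr
        refine hmain.trans (ENNReal.ofReal_le_ofReal ?_)
        linarith [Real.add_one_le_exp (t * CI + 2 * CSG * t ^ 2)]
    _ = _ := by
        rw [← ENNReal.ofReal_mul (Real.exp_pos _).le, ← Real.exp_add]
        congr 2; ring

/-- Averaging over the sign cancels the linear terms `± t * CI`. The condition `|t| * CI ≤ 1` keeps
both bounds nonnegative, so that they add inside `ENNReal.ofReal`. -/
theorem lintegral_exp_sign_le [IsProbabilityMeasure μ] (hμ : IsEnsemble μ CI CSI CSG)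
    (hCSG : 0 < CSG) (hCI : 0 < CI)
    {z : EuclideanSpace ℂ (Fin n)} (hz : ‖z‖ = 1) {t : ℝ} (ht : |t| ≤ 1 / 2) (htCI : |t| * CI ≤ 1) :
    ∫⁻ b, ENNReal.ofReal (Real.exp (t * (b.2 * ‖inner ℂ b.1 z‖ ^ 2))) ∂(μ.prod signMeasure) ≤
      ENNReal.ofReal (Real.exp (2 * CSG * t ^ 2)) := by
  have key {s : ℝ} (hs0 : 0 ≤ s) (hs : s ≤ 1 / 2) (hsCI : s * CI ≤ 1) :
      ∫⁻ a, (2⁻¹ * ENNReal.ofReal (Real.exp (s * ‖inner ℂ a z‖ ^ 2)) +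
        2⁻¹ * ENNReal.ofReal (Real.exp (-(s * ‖inner ℂ a z‖ ^ 2)))) ∂μ ≤
      ENNReal.ofReal (Real.exp (2 * CSG * s ^ 2)) := by
    have hpos : 0 ≤ CSG * s ^ 2 := by positivity
    have h0 : 0 ≤ s * CI := by positivity
    rw [lintegral_add_left (by fun_prop), lintegral_const_mul _ (by fun_prop),
      lintegral_const_mul _ (by fun_prop)]
    calc _ ≤ 2⁻¹ * ENNReal.ofReal (1 + s * CI + 2 * CSG * s ^ 2) +
          2⁻¹ * ENNReal.ofReal (1 - s * CI + CSG * s ^ 2) := by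
          gcongr
          · exact hμ.lintegral_exp_le hCSG hCI hz hs0 hs
          · exact hμ.lintegral_exp_neg_le hz hs0
      _ = ENNReal.ofReal (1 + 3 / 2 * (CSG * s ^ 2)) := by
          rw [← mul_add, ← ENNReal.ofReal_add (by linarith) (by linarith),
            ← ENNReal.ofReal_ofNat 2, ← ENNReal.ofReal_inv_of_pos (by norm_num),
            ← ENNReal.ofReal_mul (by norm_num)]
          congr 1; ring
      _ ≤ _ := by
          apply ENNReal.ofReal_le_ofReal
          linarith [Real.add_one_le_exp (2 * CSG * s ^ 2)]
  rw [lintegral_prod_signMeasure _ (by fun_prop)]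
  simp only [one_mul, neg_one_mul, mul_neg]
  rcases le_total 0 t with h | h
  · rw [abs_of_nonneg h] at ht htCI
    exact key h ht htCI
  · rw [abs_of_nonpos h] at ht htCI
    have := key (neg_nonneg.2 h) ht htCI
    simp only [neg_mul, neg_neg, even_two.neg_pow] at this
    simpa only [add_comm] using this

/-- A lower bound for the mean of a truncation, from the second and fourth moments. -/
theorem le_integral_min [IsProbabilityMeasure μ] (hμ : IsEnsemble μ CI CSI CSG)
    {J : Type*} [Fintype J] {v : J → EuclideanSpace ℂ (Fin n)} (hv : ∀ j, ‖v j‖ = 1)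
    {l : J → ℝ} {L : ℝ} (hl : ∑ j, |l j| ≤ L) (hL : 0 < L) (hCSG : 0 < CSG) {B : ℝ} (hB : 0 < B)
    (h2 : CSI ≤ ∫ a, (∑ j, l j * ‖inner ℂ a (v j)‖ ^ 2) ^ 2 ∂μ) :
    CSI / B - 24 * L ^ 4 * CSG / B ^ 3 ≤
      ∫ a, min |∑ j, l j * ‖inner ℂ a (v j)‖ ^ 2| B ∂μ := by
  set u : EuclideanSpace ℂ (Fin n) → ℝ := fun a => ∑ j, l j * ‖inner ℂ a (v j)‖ ^ 2 with hu
  have hum : Measurable u := by fun_prop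
  -- Jensen with weights `|l j|` dominates `u ^ 4` by `R`; the moment of order `N = 4` then
  -- contributes `4! = 24`.
  let R : EuclideanSpace ℂ (Fin n) → ℝ := fun a => L ^ 3 * ∑ j, |l j| * (‖inner ℂ a (v j)‖ ^ 2) ^ 4
  have hRint : Integrable R μ := (integrable_finsetSum _ fun j _ =>
    (hμ.integrable_pow (hv j) (by norm_num)).const_mul _).const_mul _
  have hle (a) : u a ^ 4 ≤ R a := by
    have hl0 : 0 ≤ ∑ j, |l j| := by positivity
    have habs : |u a| ≤ ∑ j, |l j| * ‖inner ℂ a (v j)‖ ^ 2 := by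
      refine (Finset.abs_sum_le_sum_abs _ _).trans (le_of_eq ?_)
      refine Finset.sum_congr rfl fun j _ => ?_
      rw [abs_mul, abs_of_nonneg (sq_nonneg ‖_‖)]
    have h4 : u a ^ 4 ≤ (∑ j, |l j| * ‖inner ℂ a (v j)‖ ^ 2) ^ 4 := by
      rw [← Even.pow_abs (by decide : Even 4)]
      gcongr
    refine h4.trans ?_
    rcases hl0.eq_or_lt with h | h
    · have : ∀ j, |l j| = 0 := fun j =>
        (Finset.sum_eq_zero_iff_of_nonneg fun j _ => abs_nonneg (l j)).1 h.symm j (Finset.mem_univ j)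
      simp [R, this]
    · have := Real.pow_arith_mean_le_arith_mean_pow Finset.univ (fun j => |l j| / ∑ j, |l j|)
        (fun j => ‖inner ℂ a (v j)‖ ^ 2) (fun j _ => by positivity)
        (by rw [← Finset.sum_div, div_self h.ne']) (fun j _ => by positivity) 4
      simp only [div_mul_eq_mul_div, ← Finset.sum_div, div_pow] at this
      rw [div_le_iff₀ (by positivity)] at this
      refine this.trans ?_
      rw [show ∀ x : ℝ, x / (∑ j, |l j|) * (∑ j, |l j|) ^ 4 = (∑ j, |l j|) ^ 3 * x by
        intro x; field_simp]
      simp only [R]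
      gcongr
  have hi4 : Integrable (fun a => u a ^ 4) μ := by
    refine hRint.mono' (by fun_prop) (.of_forall fun a => ?_)
    rw [Real.norm_eq_abs, abs_of_nonneg (by positivity)]
    exact hle a
  have hi2 : Integrable (fun a => u a ^ 2) μ := by
    refine ((integrable_const 1).add hi4).mono' (by fun_prop) (.of_forall fun a => ?_)
    rw [Real.norm_eq_abs, abs_of_nonneg (by positivity)]
    simp only [Pi.add_apply]
    nlinarith [sq_nonneg (u a ^ 2 - 1), sq_nonneg (u a)]
  have hmom : ∫ a, u a ^ 4 ∂μ ≤ 24 * L ^ 4 * CSG := by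
    refine (integral_mono hi4 hRint hle).trans ?_
    simp only [R]
    rw [integral_const_mul, integral_finsetSum _ fun j _ =>
      (hμ.integrable_pow (hv j) (by norm_num)).const_mul _]
    simp only [integral_const_mul]
    calc L ^ 3 * ∑ j, |l j| * ∫ a, (‖inner ℂ a (v j)‖ ^ 2) ^ 4 ∂μ
        ≤ L ^ 3 * ∑ j, |l j| * (CSG * (Nat.factorial 4 : ℕ)) := by
          gcongr with j
          exact hμ.integral_pow_le (hv j) (by norm_num)
      _ = L ^ 3 * ((∑ j, |l j|) * (CSG * 24)) := by
          rw [Finset.sum_mul]; norm_num [Nat.factorial]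
      _ ≤ L ^ 3 * (L * (CSG * 24)) := by gcongr
      _ = _ := by ring
  have hpt (a) : u a ^ 2 / B - u a ^ 4 / B ^ 3 ≤ min |u a| B := by
    have h : u a ^ 2 / B - u a ^ 4 / B ^ 3 = (|u a| ^ 2 * (B ^ 2 - |u a| ^ 2)) / B ^ 3 := by
      rw [← Even.pow_abs (by decide : Even 4), ← sq_abs]
      field_simp
    rw [h, div_le_iff₀ (by positivity)]
    have h0 := abs_nonneg (u a)
    generalize |u a| = x at h0
    rcases le_total x B with hx | hx
    · rw [min_eq_left hx]
      have : x * (B ^ 2 - x ^ 2) ≤ B ^ 3 := by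
        nlinarith [mul_nonneg h0 (sq_nonneg x), mul_nonneg (sub_nonneg.2 hx) (sq_nonneg B)]
      nlinarith [mul_le_mul_of_nonneg_left this h0]
    · rw [min_eq_right hx]
      have : x ^ 2 * (B ^ 2 - x ^ 2) ≤ 0 :=
        mul_nonpos_of_nonneg_of_nonpos (by positivity) (by nlinarith)
      exact this.trans (by positivity)
  calc CSI / B - 24 * L ^ 4 * CSG / B ^ 3 ≤ (∫ a, u a ^ 2 ∂μ) / B - (∫ a, u a ^ 4 ∂μ) / B ^ 3 := by
        gcongr
    _ = ∫ a, (u a ^ 2 / B - u a ^ 4 / B ^ 3) ∂μ := by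
        rw [integral_sub (hi2.div_const _) (hi4.div_const _), integral_div, integral_div]
    _ ≤ _ := by
        refine integral_mono ((hi2.div_const _).sub (hi4.div_const _)) ?_ hpt
        refine .of_bound (by fun_prop) B (.of_forall fun a => ?_)
        rw [Real.norm_eq_abs, abs_of_nonneg (le_min (abs_nonneg _) hB.le)]
        exact min_le_right _ _

end IsEnsemble

/-! ### Tail bounds for independent samples -/

/-- The exponential Markov inequality. -/
theorem measure_ofReal_exp_le {Ω : Type*} [MeasurableSpace Ω] (P : Measure Ω) {F : Ω → ℝ≥0∞}
    (hF : Measurable F) {A : ℝ} (h : ∫⁻ a, F a ∂P ≤ ENNReal.ofReal A) (r : ℝ) :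
    P {a | ENNReal.ofReal (Real.exp r) ≤ F a} ≤ ENNReal.ofReal (A * Real.exp (-r)) := by
  have h1 := (mul_meas_ge_le_lintegral (μ := P) hF (ENNReal.ofReal (Real.exp r))).trans h
  have h2 : ENNReal.ofReal (Real.exp (-r)) * ENNReal.ofReal (Real.exp r) = 1 := by
    rw [← ENNReal.ofReal_mul (Real.exp_pos _).le, ← Real.exp_add]
    simp
  calc P {a | ENNReal.ofReal (Real.exp r) ≤ F a}
      = ENNReal.ofReal (Real.exp (-r)) *
        (ENNReal.ofReal (Real.exp r) * P {a | ENNReal.ofReal (Real.exp r) ≤ F a}) := by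
        rw [← mul_assoc, h2, one_mul]
    _ ≤ ENNReal.ofReal (Real.exp (-r)) * ENNReal.ofReal A := by gcongr
    _ = _ := by rw [← ENNReal.ofReal_mul (Real.exp_pos _).le, mul_comm]

/-- The Chernoff bound for independent samples. -/
theorem measure_pi_le_sum_le {E : Type*} [MeasurableSpace E] (μ : Measure E)
    [IsProbabilityMeasure μ] {h : E → ℝ} (hh : Measurable h) {c : ℝ}
    (H : ∫⁻ a, ENNReal.ofReal (Real.exp (h a)) ∂μ ≤ ENNReal.ofReal (Real.exp c)) (m : ℕ) (r : ℝ) :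
    (Measure.pi fun _ : Fin m => μ) {a | r ≤ ∑ k, h (a k)} ≤
      ENNReal.ofReal (Real.exp (m * c - r)) := by
  have := measure_ofReal_exp_le _ (by fun_prop) (lintegral_pi_exp_sum_le μ hh H m) r
  rw [← Real.exp_add, ← sub_eq_add_neg] at this
  simpa [ENNReal.ofReal_le_ofReal_iff (Real.exp_pos _).le] using this

namespace IsEnsemble

variable {n : ℕ} {μ : Measure (EuclideanSpace ℂ (Fin n))} {CI CSI CSG : ℝ}

/-- Concentration of the empirical second moments in finitely many directions. -/
theorem measure_deviation_le [IsProbabilityMeasure μ] (hμ : IsEnsemble μ CI CSI CSG)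
    (hCSG : 0 < CSG) (hCI : 0 < CI) {N : Finset (EuclideanSpace ℂ (Fin n))}
    (hN : ∀ v ∈ N, ‖v‖ = 1) {t : ℝ} (ht0 : 0 < t) (ht : t ≤ 1 / 2) (δ : ℝ) (m : ℕ) :
    (Measure.pi fun _ : Fin m => μ)
      {a | ∃ v ∈ N, m * δ ≤ |∑ k, (‖inner ℂ (a k) v‖ ^ 2 - CI)|} ≤
    ENNReal.ofReal (2 * N.card * Real.exp (-(m * (t * δ - 2 * CSG * t ^ 2)))) := by
  have key (v) (hv : v ∈ N) (s : ℝ) (hs : |s| = t) : (Measure.pi fun _ : Fin m => μ)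
      {a | t * (m * δ) ≤ ∑ k, s * (‖inner ℂ (a k) v‖ ^ 2 - CI)} ≤
      ENNReal.ofReal (Real.exp (-(m * (t * δ - 2 * CSG * t ^ 2)))) := by
    have h1 := hμ.lintegral_exp_centered_le hCSG hCI (hN v hv) (t := s) (by rw [hs]; exact ht)
    have h2 := measure_pi_le_sum_le μ (by fun_prop) h1 m (t * (m * δ))
    rw [← sq_abs, hs] at h2
    refine h2.trans (le_of_eq ?_)
    congr 2; ring
  have hsub : {a : Fin m → EuclideanSpace ℂ (Fin n) |
        ∃ v ∈ N, m * δ ≤ |∑ k, (‖inner ℂ (a k) v‖ ^ 2 - CI)|} ⊆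
      ⋃ v ∈ N, ({a | t * (m * δ) ≤ ∑ k, t * (‖inner ℂ (a k) v‖ ^ 2 - CI)} ∪
        {a | t * (m * δ) ≤ ∑ k, (-t) * (‖inner ℂ (a k) v‖ ^ 2 - CI)}) := by
    rintro a ⟨v, hv, hle⟩
    refine Set.mem_biUnion hv ?_
    simp only [Set.mem_union, Set.mem_ofPred_eq, ← Finset.mul_sum]
    rcases le_abs.1 hle with h | h
    · exact Or.inl (mul_le_mul_of_nonneg_left h ht0.le)
    · right
      rw [neg_mul, ← mul_neg]
      exact mul_le_mul_of_nonneg_left h ht0.le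
  refine (measure_mono hsub).trans ((measure_biUnion_finset_le _ _).trans ?_)
  calc _ ≤ ∑ v ∈ N, (ENNReal.ofReal (Real.exp (-(m * (t * δ - 2 * CSG * t ^ 2)))) +
        ENNReal.ofReal (Real.exp (-(m * (t * δ - 2 * CSG * t ^ 2))))) := by
        refine Finset.sum_le_sum fun v hv => (measure_union_le _ _).trans (add_le_add ?_ ?_)
        · exact key v hv t (abs_of_pos ht0)
        · exact key v hv (-t) (by rw [abs_neg, abs_of_pos ht0])
    _ = _ := by
        rw [Finset.sum_const, ← ENNReal.ofReal_add (Real.exp_pos _).le (Real.exp_pos _).le,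
          ← two_mul, nsmul_eq_mul, ← ENNReal.ofReal_natCast, ← ENNReal.ofReal_mul (by positivity)]
        congr 1; ring

/-- Uniform lower deviation of truncated quadratic forms with bounded nuclear norm. -/
theorem measure_truncated_deviation_le [IsProbabilityMeasure μ] (hμ : IsEnsemble μ CI CSI CSG)
    (hCSG : 0 < CSG) (hCI : 0 < CI) {N : Finset (EuclideanSpace ℂ (Fin n))} (hNe : N.Nonempty)
    (hN1 : ∀ v ∈ N, ‖v‖ = 1) (hN : ∀ x, ‖x‖ = 1 → ∃ v ∈ N, ‖x - v‖ < 1 / 2)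
    {ι J : Type*} [Finite ι] [Fintype J] {v : ι → J → EuclideanSpace ℂ (Fin n)}
    (hv : ∀ i j, ‖v i j‖ = 1) {l : ι → J → ℝ} {L : ℝ} (hl : ∀ i, ∑ j, |l i j| ≤ L) (hL : 0 < L)
    {B : ℝ} (hB : 0 < B) {s : ℝ} (hs0 : 0 < s) (hs : 64 * L * s ≤ 1 / 2)
    (hsCI : 64 * L * s * CI ≤ 1) (r : ℝ) (m : ℕ) :
    (Measure.pi fun _ : Fin m => μ)
      {a | ∃ i, r ≤ ∑ k, ((∫ a', min |∑ j, l i j * ‖inner ℂ a' (v i j)‖ ^ 2| B ∂μ) -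
        min |∑ j, l i j * ‖inner ℂ (a k) (v i j)‖ ^ 2| B)} ≤
    ENNReal.ofReal (2 * N.card * Real.exp (-(s * r - m * (2 * CSG * (64 * L * s) ^ 2)))) := by
  -- The factors are `2` from symmetrization, `32` from the net, and `L` from the nuclear norm.
  set t := 64 * L * s with ht
  have ht0 : 0 < t := by positivity
  let u : ι → EuclideanSpace ℂ (Fin n) → ℝ := fun i a => ∑ j, l i j * ‖inner ℂ a (v i j)‖ ^ 2
  let f : ι → EuclideanSpace ℂ (Fin n) → ℝ := fun i a => s * min |u i a| B
  have hu (i) : Measurable (u i) := by fun_prop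
  have hf (i) : Measurable (f i) := by have := hu i; fun_prop
  have hclip (i a) : |f i a| = f i a :=
    abs_of_nonneg (mul_nonneg hs0.le (le_min (abs_nonneg _) hB.le))
  have hstep := lintegral_supExp_centered_le μ hf (u := fun i a => s * u i a)
    (fun i => (hu i).const_mul s) (B := s * B)
    (fun i a => by
      rw [hclip]
      exact mul_le_mul_of_nonneg_left (min_le_right _ _) hs0.le)
    (fun i a => by
      rw [hclip, abs_mul, abs_of_pos hs0]
      exact mul_le_mul_of_nonneg_left (min_le_left _ _) hs0.le)
    (fun i j a => by
      simp only [f, ← mul_sub, abs_mul, abs_of_pos hs0]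
      refine mul_le_mul_of_nonneg_left ?_ hs0.le
      refine (abs_min_sub_min_le_max _ _ _ _).trans ?_
      rw [sub_self, abs_zero, max_eq_left (abs_nonneg _)]
      exact abs_abs_sub_abs_le_abs_sub _ _)
  have htensor := lintegral_pi_supExp_le μ (μ.prod signMeasure)
    (h := fun i a => (∫ a', f i a' ∂μ) - f i a) (w := fun i b => b.2 * (2 * (s * u i b.1)))
    (fun i => (hf i).const_sub _) (fun i => by have := hu i; fun_prop) hstep m 0
  simp only [Pi.zero_apply, zero_add] at htensor
  -- The linearized process is a combination of values of one quadratic function `Q` with weights of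
  -- total mass at most `L`. The net thus controls all `i` at once, and the size of `ι` plays no
  -- role.
  have hsup (b : Fin m → EuclideanSpace ℂ (Fin n) × ℝ) :
      supExp (fun i => ∑ k, (b k).2 * (2 * (s * u i (b k).1))) ≤
        ∑ v ∈ N, (ENNReal.ofReal (Real.exp (∑ k, t * ((b k).2 * ‖inner ℂ (b k).1 v‖ ^ 2))) +
          ENNReal.ofReal (Real.exp (∑ k, (-t) * ((b k).2 * ‖inner ℂ (b k).1 v‖ ^ 2)))) := by
    let Q : EuclideanSpace ℂ (Fin n) → ℝ := fun x => ∑ k, (b k).2 * ‖inner ℂ (b k).1 x‖ ^ 2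
    obtain ⟨v₀, hv₀, hmax⟩ := N.exists_max_image (fun v => |Q v|) hNe
    have hQ (x) (hx : ‖x‖ = 1) : |Q x| ≤ 32 * |Q v₀| := by
      simpa [hx, Q] using abs_weighted_le_of_net hN1 hN (fun k => (b k).1) (fun k => (b k).2) 0
        (M := |Q v₀|) (fun v hv => by simpa using hmax v hv) x
    refine iSup_le fun i => ?_
    have hsum : ∑ k, (b k).2 * (2 * (s * u i (b k).1)) = 2 * s * ∑ j, l i j * Q (v i j) := by
      simp only [u, Q, Finset.mul_sum]
      rw [Finset.sum_comm]
      exact Finset.sum_congr rfl fun j _ => Finset.sum_congr rfl fun k _ => by ring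
    have hle : ∑ k, (b k).2 * (2 * (s * u i (b k).1)) ≤ t * |Q v₀| := by
      rw [hsum]
      calc 2 * s * ∑ j, l i j * Q (v i j) ≤ 2 * s * ∑ j, |l i j| * (32 * |Q v₀|) := by
            gcongr 2 * s * ?_
            refine Finset.sum_le_sum fun j _ => (le_abs_self _).trans ?_
            rw [abs_mul]
            exact mul_le_mul_of_nonneg_left (hQ _ (hv i j)) (abs_nonneg _)
        _ = 2 * s * ((∑ j, |l i j|) * (32 * |Q v₀|)) := by rw [Finset.sum_mul]
        _ ≤ 2 * s * (L * (32 * |Q v₀|)) := by gcongr; exact hl i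
        _ = _ := by rw [ht]; ring
    refine le_trans ?_ (Finset.single_le_sum (f := fun v =>
      ENNReal.ofReal (Real.exp (∑ k, t * ((b k).2 * ‖inner ℂ (b k).1 v‖ ^ 2))) +
        ENNReal.ofReal (Real.exp (∑ k, (-t) * ((b k).2 * ‖inner ℂ (b k).1 v‖ ^ 2))))
      (fun _ _ => zero_le) hv₀)
    simp only [← Finset.mul_sum]
    rcases abs_cases (Q v₀) with ⟨h, _⟩ | ⟨h, _⟩ <;> rw [h] at hle
    · exact le_add_right (ENNReal.ofReal_le_ofReal (Real.exp_le_exp.2 hle))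
    · rw [mul_neg, ← neg_mul] at hle
      exact le_add_left (ENNReal.ofReal_le_ofReal (Real.exp_le_exp.2 hle))
  have hsign (v) (hvN : v ∈ N) (t' : ℝ) (ht' : |t'| = t) :
      ∫⁻ b, ENNReal.ofReal (Real.exp (∑ k, t' * ((b k).2 * ‖inner ℂ (b k).1 v‖ ^ 2)))
        ∂(Measure.pi fun _ : Fin m => μ.prod signMeasure) ≤
      ENNReal.ofReal (Real.exp (m * (2 * CSG * t ^ 2))) := by
    have h1 := hμ.lintegral_exp_sign_le hCSG hCI (hN1 v hvN) (t := t') (by rwa [ht'])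
      (by rwa [ht'])
    have h2 := lintegral_pi_exp_sum_le _ (by fun_prop) h1 m
    rwa [← sq_abs, ht'] at h2
  have htotal : ∫⁻ a, supExp (fun i => ∑ k, ((∫ a', f i a' ∂μ) - f i (a k)))
        ∂(Measure.pi fun _ : Fin m => μ) ≤
      ENNReal.ofReal (2 * N.card * Real.exp (m * (2 * CSG * t ^ 2))) := by
    refine htensor.trans ((lintegral_mono hsup).trans ?_)
    rw [lintegral_finsetSum _ fun v _ => by fun_prop]
    calc _ ≤ ∑ v ∈ N, (ENNReal.ofReal (Real.exp (m * (2 * CSG * t ^ 2))) +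
          ENNReal.ofReal (Real.exp (m * (2 * CSG * t ^ 2)))) := by
          refine Finset.sum_le_sum fun v hvN => ?_
          rw [lintegral_add_left (by fun_prop)]
          exact add_le_add (hsign v hvN t (abs_of_pos ht0))
            (hsign v hvN (-t) (by rw [abs_neg, abs_of_pos ht0]))
      _ = _ := by
          rw [Finset.sum_const, ← ENNReal.ofReal_add (Real.exp_pos _).le (Real.exp_pos _).le,
            ← two_mul, nsmul_eq_mul, ← ENNReal.ofReal_natCast, ← ENNReal.ofReal_mul (by positivity)]
          congr 1; ring
  have hfinal := measure_ofReal_exp_le _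
    (measurable_supExp fun i => by have := hf i; fun_prop) htotal (s * r)
  rw [mul_assoc, ← Real.exp_add] at hfinal
  refine (measure_mono ?_).trans (hfinal.trans (le_of_eq ?_))
  · rintro a ⟨i, hi⟩
    refine le_trans (ENNReal.ofReal_le_ofReal (Real.exp_le_exp.2 ?_)) (exp_le_supExp _ i)
    simp only [f, integral_const_mul, ← mul_sub, ← Finset.mul_sum]
    exact mul_le_mul_of_nonneg_left hi hs0.le
  · congr 3; ring

end IsEnsemble

/-! ### Hermitian matrices and their quadratic forms -/

section Matrices

variable {n : ℕ}

theorem hsNorm_nonneg (X : Matrix (Fin n) (Fin n) ℂ) : 0 ≤ hsNorm X :=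
  Real.sqrt_nonneg _

theorem hsNorm_sq (X : Matrix (Fin n) (Fin n) ℂ) : hsNorm X ^ 2 = ∑ i, ∑ j, ‖X i j‖ ^ 2 := by
  have h : (Matrix.trace (X * X.conjTranspose)).re = ∑ i, ∑ j, ‖X i j‖ ^ 2 := by
    simp only [Matrix.trace, Matrix.diag_apply, Matrix.mul_apply, Matrix.conjTranspose_apply,
      Complex.re_sum]
    refine Finset.sum_congr rfl fun i _ => Finset.sum_congr rfl fun j _ => ?_
    rw [Complex.star_def, Complex.mul_conj, Complex.normSq_eq_norm_sq, Complex.ofReal_re]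
  rw [hsNorm, h, Real.sq_sqrt (by positivity)]

theorem norm_apply_le_hsNorm (X : Matrix (Fin n) (Fin n) ℂ) (i j : Fin n) :
    ‖X i j‖ ≤ hsNorm X := by
  refine le_of_sq_le_sq ?_ (hsNorm_nonneg X)
  rw [hsNorm_sq]
  exact (Finset.single_le_sum (f := fun j => ‖X i j‖ ^ 2) (fun _ _ => by positivity)
    (Finset.mem_univ j)).trans (Finset.single_le_sum (f := fun i => ∑ j, ‖X i j‖ ^ 2)
      (fun _ _ => by positivity) (Finset.mem_univ i))

theorem hsNorm_smul (r : ℝ) (X : Matrix (Fin n) (Fin n) ℂ) :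
    hsNorm (r • X) = |r| * hsNorm X := by
  rw [← sq_eq_sq₀ (hsNorm_nonneg _) (mul_nonneg (abs_nonneg r) (hsNorm_nonneg X)), mul_pow,
    hsNorm_sq, hsNorm_sq]
  simp [mul_pow, Finset.mul_sum]

theorem quadForm_eq_inner (X : Matrix (Fin n) (Fin n) ℂ) (a : EuclideanSpace ℂ (Fin n)) :
    quadForm X a = inner ℂ a (Matrix.toEuclideanLin X a) := by
  rw [EuclideanSpace.inner_eq_star_dotProduct, dotProduct_comm]
  rfl

theorem quadForm_sub (X Y : Matrix (Fin n) (Fin n) ℂ) (a : EuclideanSpace ℂ (Fin n)) :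
    quadForm (X - Y) a = quadForm X a - quadForm Y a := by
  simp [quadForm, Matrix.sub_mulVec, dotProduct_sub]

theorem quadForm_smul (r : ℝ) (X : Matrix (Fin n) (Fin n) ℂ) (a : EuclideanSpace ℂ (Fin n)) :
    quadForm (r • X) a = r * quadForm X a := by
  simp [quadForm, Matrix.smul_mulVec, dotProduct_smul]

theorem quadForm_ketBra (x a : EuclideanSpace ℂ (Fin n)) :
    quadForm (ketBra x) a = (‖inner ℂ a x‖ ^ 2 : ℝ) := by
  rw [quadForm, ketBra, Matrix.vecMulVec_mulVec, dotProduct_smul, Complex.ofReal_pow,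
    ← Complex.mul_conj', inner_conj_symm, EuclideanSpace.inner_eq_star_dotProduct,
    EuclideanSpace.inner_eq_star_dotProduct, dotProduct_comm x.ofLp, dotProduct_comm a.ofLp]
  simp

theorem trace_ketBra_mul (a : EuclideanSpace ℂ (Fin n)) (Z : Matrix (Fin n) (Fin n) ℂ) :
    Matrix.trace (ketBra a * Z) = quadForm Z a := by
  rw [Matrix.trace_mul_comm, ketBra, Matrix.mul_vecMulVec, Matrix.trace_vecMulVec, dotProduct_comm]
  rfl

theorem posSemidef_ketBra (x : EuclideanSpace ℂ (Fin n)) : (ketBra x).PosSemidef :=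
  Matrix.posSemidef_vecMulVec_self_star _

theorem norm_quadForm_le {X : Matrix (Fin n) (Fin n) ℂ} {η : ℝ} (hX : ∀ i j, ‖X i j‖ ≤ η)
    (a : EuclideanSpace ℂ (Fin n)) : ‖quadForm X a‖ ≤ η * n * ‖a‖ ^ 2 := by
  rcases isEmpty_or_nonempty (Fin n) with h | ⟨⟨i₀⟩⟩
  · simp [quadForm, EuclideanSpace.norm_eq]
  have hη : 0 ≤ η := (norm_nonneg _).trans (hX i₀ i₀)
  have h1 : ‖quadForm X a‖ ≤ ∑ i, ∑ j, ‖a i‖ * (η * ‖a j‖) := by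
    simp only [quadForm, dotProduct, Matrix.mulVec, Finset.mul_sum]
    refine (norm_sum_le _ _).trans (Finset.sum_le_sum fun i _ => (norm_sum_le _ _).trans
      (Finset.sum_le_sum fun j _ => ?_))
    simp only [norm_mul, Pi.star_apply, norm_star]
    gcongr
    exact hX i j
  have h2 : ∑ i, ∑ j, ‖a i‖ * (η * ‖a j‖) = η * (∑ i, ‖a i‖) ^ 2 := by
    rw [sq, Finset.sum_mul_sum, Finset.mul_sum]
    refine Finset.sum_congr rfl fun i _ => ?_
    rw [Finset.mul_sum]
    exact Finset.sum_congr rfl fun j _ => by ring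
  have h3 : (∑ i, ‖a i‖) ^ 2 ≤ n * ∑ i, ‖a i‖ ^ 2 := by
    simpa using sq_sum_le_card_mul_sum_sq (s := Finset.univ) (f := fun i => ‖a i‖)
  rw [← EuclideanSpace.norm_sq_eq] at h3
  rw [mul_assoc]
  exact h1.trans (h2.le.trans (mul_le_mul_of_nonneg_left h3 hη))

theorem quadForm_eq_sum_eigenvalues {X : Matrix (Fin n) (Fin n) ℂ} (hX : X.IsHermitian)
    (a : EuclideanSpace ℂ (Fin n)) :
    quadForm X a = (∑ j, hX.eigenvalues j * ‖inner ℂ a (hX.eigenvectorBasis j)‖ ^ 2 : ℝ) := by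
  have hsymm : (Matrix.toEuclideanLin X).IsSymmetric := Matrix.isSymmetric_toEuclideanLin_iff.2 hX
  rw [quadForm_eq_inner, ← hX.eigenvectorBasis.sum_inner_mul_inner, Complex.ofReal_sum]
  refine Finset.sum_congr rfl fun j _ => ?_
  have heig : Matrix.toEuclideanLin X (hX.eigenvectorBasis j) =
      (hX.eigenvalues j : ℂ) • hX.eigenvectorBasis j := by
    ext i
    simpa [Matrix.toLpLin_apply] using congrFun (hX.mulVec_eigenvectorBasis j) i
  rw [← hsymm, heig, inner_smul_left, Complex.conj_ofReal, ← inner_conj_symm _ a, Complex.ofReal_mul,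
    Complex.ofReal_pow, ← Complex.mul_conj']
  ring

theorem hsNorm_sq_eq_sum_eigenvalues {X : Matrix (Fin n) (Fin n) ℂ} (hX : X.IsHermitian) :
    hsNorm X ^ 2 = ∑ j, hX.eigenvalues j ^ 2 := by
  have h : Matrix.trace (X * X.conjTranspose) = (∑ j, hX.eigenvalues j ^ 2 : ℝ) := by
    rw [hX.eq]
    conv_lhs => rw [hX.spectral_theorem]
    rw [← map_mul, Matrix.diagonal_mul_diagonal, Unitary.conjStarAlgAut_apply,
      Matrix.trace_mul_cycle, Unitary.coe_star_mul_self, one_mul, Matrix.trace_diagonal]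
    simp [sq]
  rw [hsNorm, h, Complex.ofReal_re, Real.sq_sqrt (by positivity)]

/-- On the orthogonal complement of `x` the form of `Z - |x⟩⟨x|` is that of `Z`, hence nonnegative.
Two distinct negative eigenvectors would span a plane meeting this hyperplane in a nonzero vector of
negative form. -/
theorem eigenvalue_eq_of_neg {x : EuclideanSpace ℂ (Fin n)} {Z : Matrix (Fin n) (Fin n) ℂ}
    (hZ : Z.PosSemidef) (hX : (Z - ketBra x).IsHermitian) {i j : Fin n}
    (hi : hX.eigenvalues i < 0) (hj : hX.eigenvalues j < 0) : i = j := by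
  by_contra hij
  set b := hX.eigenvectorBasis with hb
  have hnonneg (w : EuclideanSpace ℂ (Fin n)) (hw : inner ℂ w x = 0) :
      0 ≤ ∑ k, hX.eigenvalues k * ‖inner ℂ w (b k)‖ ^ 2 := by
    have h1 := quadForm_eq_sum_eigenvalues hX w
    rw [quadForm_sub, quadForm_ketBra, hw] at h1
    have h2 : 0 ≤ quadForm Z w := hZ.dotProduct_mulVec_nonneg _
    rw [norm_zero, zero_pow two_ne_zero, Complex.ofReal_zero, sub_zero] at h1
    rw [h1] at h2
    exact_mod_cast h2
  have hin (k l : Fin n) : inner ℂ (b k) (b l) = if k = l then (1 : ℂ) else 0 :=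
    orthonormal_iff_ite.1 b.orthonormal k l
  set p := inner ℂ (b i) x with hp
  set q := inner ℂ (b j) x with hq
  by_cases hp0 : p = 0
  · have := hnonneg (b i) hp0
    rw [Finset.sum_eq_single i (fun k _ hk => by simp [hin, hk.symm]) (by simp)] at this
    simp at this
    linarith
  · have hw : inner ℂ ((starRingEnd ℂ q) • b i - (starRingEnd ℂ p) • b j) x = 0 := by
      rw [inner_sub_left, inner_smul_left, inner_smul_left, Complex.conj_conj, Complex.conj_conj,
        ← hp, ← hq]
      ring
    have := hnonneg _ hw
    have hterm (k : Fin n) : hX.eigenvalues k *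
        ‖inner ℂ ((starRingEnd ℂ q) • b i - (starRingEnd ℂ p) • b j) (b k)‖ ^ 2 ≤
        if k = j then hX.eigenvalues j * ‖p‖ ^ 2 else 0 := by
      rw [inner_sub_left, inner_smul_left, inner_smul_left, Complex.conj_conj, Complex.conj_conj,
        hin, hin]
      by_cases hkj : k = j
      · subst hkj
        simp [hij]
      · by_cases hki : k = i
        · subst hki
          simpa [hkj, Ne.symm hkj] using mul_nonpos_of_nonpos_of_nonneg hi.le (sq_nonneg ‖q‖)
        · simp [hkj, Ne.symm hkj, Ne.symm hki]
    have hle := this.trans (Finset.sum_le_sum fun k _ => hterm k)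
    rw [Finset.sum_ite_eq' Finset.univ j] at hle
    simp only [Finset.mem_univ, if_true] at hle
    nlinarith [mul_pos_of_neg_of_neg hj (neg_neg_of_pos (pow_pos (norm_pos_iff.2 hp0) 2))]

/-- The negative part of `Z - |x⟩⟨x|` is dominated by the Hilbert-Schmidt norm. -/
theorem sum_negPart_eigenvalues_le {x : EuclideanSpace ℂ (Fin n)} {Z : Matrix (Fin n) (Fin n) ℂ}
    (hZ : Z.PosSemidef) (hX : (Z - ketBra x).IsHermitian) :
    ∑ j, max (-hX.eigenvalues j) 0 ≤ hsNorm (Z - ketBra x) := by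
  by_cases h : ∃ i, hX.eigenvalues i < 0
  · obtain ⟨i, hi⟩ := h
    rw [Finset.sum_eq_single i (fun j _ hji => ?_) (by simp)]
    · refine le_of_sq_le_sq ?_ (hsNorm_nonneg _)
      rw [hsNorm_sq_eq_sum_eigenvalues hX, max_eq_left (by linarith), neg_sq]
      exact Finset.single_le_sum (f := fun j => hX.eigenvalues j ^ 2) (fun _ _ => sq_nonneg _)
        (Finset.mem_univ i)
    · refine max_eq_right (neg_nonpos.2 (not_lt.1 fun hj => hji ?_))
      exact eigenvalue_eq_of_neg hZ hX hj hi
  · push Not at h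
    rw [Finset.sum_eq_zero fun j _ => max_eq_right (neg_nonpos.2 (h j))]
    exact hsNorm_nonneg _

theorem hsNorm_le_trace {Z : Matrix (Fin n) (Fin n) ℂ} (hZ : Z.PosSemidef) :
    hsNorm Z ≤ Z.trace.re := by
  have h : Z.trace.re = ∑ j, hZ.isHermitian.eigenvalues j := by
    rw [hZ.isHermitian.trace_eq_sum_eigenvalues, Complex.re_sum]
    simp
  have h0 := hZ.eigenvalues_nonneg
  rw [h]
  refine le_of_sq_le_sq ?_ (Finset.sum_nonneg fun j _ => h0 j)
  rw [hsNorm_sq_eq_sum_eigenvalues hZ.isHermitian]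
  exact Finset.sum_sq_le_sq_sum_of_nonneg fun j _ => h0 j

theorem isClosed_setOf_posSemidef : IsClosed {Z : Matrix (Fin n) (Fin n) ℂ | Z.PosSemidef} := by
  simp only [Matrix.posSemidef_iff_dotProduct_mulVec, Set.ofPred_and, Set.ofPred_forall]
  refine IsClosed.inter ?_ (isClosed_iInter fun x => ?_)
  · exact isClosed_eq (by fun_prop) continuous_id
  · exact isClosed_le continuous_const (by fun_prop)

end Matrices

/-! ### The good event -/

/-- The empirical second moments of the sample are within a factor `1/2` of isotropy. -/
def NearIsotropic {n m : ℕ} (CI : ℝ) (a : Fin m → EuclideanSpace ℂ (Fin n)) : Prop :=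
  ∀ v, |∑ k, ‖inner ℂ (a k) v‖ ^ 2 - m * CI * ‖v‖ ^ 2| ≤ m * (CI / 2) * ‖v‖ ^ 2

/-- Normalized Hermitian matrices of nuclear norm at most `L`. -/
def IsCompressible {n : ℕ} (L : ℝ) (X : Matrix (Fin n) (Fin n) ℂ) : Prop :=
  X.IsHermitian ∧ hsNorm X = 1 ∧ ∃ (v : Fin n → EuclideanSpace ℂ (Fin n)) (l : Fin n → ℝ),
    (∀ j, ‖v j‖ = 1) ∧ ∑ j, |l j| ≤ L ∧
      ∀ a, (quadForm X a).re = ∑ j, l j * ‖inner ℂ a (v j)‖ ^ 2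

theorem sum_norm_sq_le {n m : ℕ} {CI : ℝ} {a : Fin m → EuclideanSpace ℂ (Fin n)}
    (ha : NearIsotropic CI a) : ∑ k, ‖a k‖ ^ 2 ≤ m * (3 / 2 * CI) * n := by
  have h1 (k) : ‖a k‖ ^ 2 = ∑ i, ‖inner ℂ (a k) (EuclideanSpace.basisFun (Fin n) ℂ i)‖ ^ 2 := by
    rw [(EuclideanSpace.basisFun (Fin n) ℂ).sum_sq_norm_inner_left]
  simp only [h1]
  rw [Finset.sum_comm]
  calc _ ≤ ∑ _i : Fin n, m * (3 / 2 * CI) := by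
        refine Finset.sum_le_sum fun i _ => ?_
        have := (abs_le.1 (ha (EuclideanSpace.basisFun (Fin n) ℂ i))).2
        rw [(EuclideanSpace.basisFun (Fin n) ℂ).orthonormal.1 i] at this
        linarith
    _ = _ := by simp [mul_comm]

/-- Entries are bounded by `hsNorm X = 1`, so total boundedness suffices. No cardinality estimate is
needed, because the deviation bound ignores the size of the family. -/
theorem exists_finite_net_isCompressible (n : ℕ) (L : ℝ) {η : ℝ} (hη : 0 < η) :
    ∃ T : Set (Matrix (Fin n) (Fin n) ℂ), T.Finite ∧ (∀ X ∈ T, IsCompressible L X) ∧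
      ∀ X : Matrix (Fin n) (Fin n) ℂ, IsCompressible L X →
        ∃ Y ∈ T, ∀ i j, ‖(X - Y) i j‖ ≤ η := by
  let S : Set (Fin n → Fin n → ℂ) := {X | IsCompressible L (Matrix.of X)}
  have hS : TotallyBounded S := by
    refine (isCompact_closedBall (0 : Fin n → Fin n → ℂ) 1).totallyBounded.subset fun X hX => ?_
    rw [mem_closedBall_zero_iff, pi_norm_le_iff_of_nonneg zero_le_one]
    refine fun i => (pi_norm_le_iff_of_nonneg zero_le_one).2 fun j => ?_
    exact hX.2.1 ▸ norm_apply_le_hsNorm (Matrix.of X) i j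
  obtain ⟨T, hTS, hT, hcover⟩ := Metric.finite_approx_of_totallyBounded hS η hη
  refine ⟨Matrix.of '' T, hT.image _, ?_, fun X hX => ?_⟩
  · rintro _ ⟨X, hX, rfl⟩
    exact hTS hX
  obtain ⟨X, rfl⟩ := Matrix.of.surjective X
  obtain ⟨Y, hY, hXY⟩ := Set.mem_iUnion₂.1 (hcover hX)
  refine ⟨Matrix.of Y, ⟨Y, hY, rfl⟩, fun i j => ?_⟩
  rw [Metric.mem_ball, dist_eq_norm] at hXY
  exact ((norm_le_pi_norm ((X - Y) i) j).trans (norm_le_pi_norm (X - Y) i)).trans hXY.le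

/-- With overwhelming probability the sample is nearly isotropic and its average absolute quadratic
form is bounded below on compressible matrices. -/
theorem exists_good_event {CI CSI CSG L : ℝ} (hCI : 0 < CI) (hCSI : 0 < CSI) (hCSG : 0 < CSG)
    (hL : 0 < L) : ∃ C c γ : ℝ, 0 < C ∧ 0 < c ∧ 0 < γ ∧ ∀ (n m : ℕ), 1 ≤ n → C * n ≤ m →
      ∀ (μ : Measure (EuclideanSpace ℂ (Fin n))) [IsProbabilityMeasure μ],
        IsEnsemble μ CI CSI CSG → ∃ G : Set (Fin m → EuclideanSpace ℂ (Fin n)),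
          MeasurableSet G ∧
          (Measure.pi fun _ : Fin m => μ) Gᶜ ≤ ENNReal.ofReal (3 * Real.exp (-γ * m)) ∧
          ∀ a ∈ G, NearIsotropic CI a ∧
            ∀ X, IsCompressible L X → c * m ≤ ∑ k, |(quadForm X (a k)).re| := by
  set K := 24 * L ^ 4 * CSG with hK
  -- With this truncation level the fourth-moment loss `K / B ^ 3` is exactly half of `CSI / B`.
  set B := √(2 * K / CSI) with hBdef
  have hKpos : 0 < K := by positivity
  have hB : 0 < B := Real.sqrt_pos.2 (by positivity)
  have hB2 : B ^ 2 = 2 * K / CSI := Real.sq_sqrt (by positivity)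
  set c₀ := CSI / (2 * B) with hc₀
  have hc₀pos : 0 < c₀ := by positivity
  have hc₀le : c₀ ≤ CSI / B - K / B ^ 3 := by
    have : K / B ^ 3 = CSI / (2 * B) := by
      have hK2 : K = B ^ 2 * CSI / 2 := by rw [hB2]; field_simp
      rw [hK2]; field_simp
    rw [this, hc₀]
    refine le_of_eq ?_
    field_simp
    norm_num
  -- The net turns `CI / 64` into `32 * CI / 64 = CI / 2`; a deviation `c₀ / 2` at `s = t / (64 *
  -- L)` has exponent `t * c₀ / (128 * L)` per sample.
  set δ := min (CI / 64) (c₀ / (128 * L)) with hδ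
  have hδpos : 0 < δ := lt_min (by positivity) (by positivity)
  -- The first two bounds are required by the exponential moments; the third makes the quadratic
  -- term at most half of `t * δ`.
  set t := min (1 / 2) (min (1 / CI) (δ / (4 * CSG))) with ht
  have htpos : 0 < t := lt_min (by norm_num) (lt_min (by positivity) (by positivity))
  have ht1 : t ≤ 1 / 2 := min_le_left _ _
  have ht2 : t * CI ≤ 1 := by
    rw [← le_div_iff₀ hCI]
    exact (min_le_right _ _).trans (min_le_left _ _)
  have ht3 : 2 * CSG * t ^ 2 ≤ t * δ / 2 := by
    have : t * (4 * CSG) ≤ δ := by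
      rw [← le_div_iff₀ (by positivity)]
      exact (min_le_right _ _).trans (min_le_right _ _)
    nlinarith
  set κ := t * δ / 2 with hκ
  have hκpos : 0 < κ := by positivity
  -- `C = 8 / κ` makes `2 * 25 ^ n ≤ exp (4 * n)` cost only half the exponent. From the mean `c₀`,
  -- deviation takes `c₀ / 2` and discretization `c₀ / 4`.
  refine ⟨8 / κ, c₀ / 4, κ / 2, by positivity, by positivity, by positivity, ?_⟩
  intro n m hn hm μ _ hμ
  obtain ⟨N, hNcard, hN1, hN⟩ := exists_sphere_net n
  have hNe : N.Nonempty := by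
    obtain ⟨v, hv, -⟩ := hN (EuclideanSpace.basisFun (Fin n) ℂ ⟨0, hn⟩)
      ((EuclideanSpace.basisFun (Fin n) ℂ).orthonormal.1 _)
    exact ⟨v, hv⟩
  set η := c₀ / (4 * (3 / 2 * CI) * n ^ 2) with hη
  have hn0 : (0 : ℝ) < n := by exact_mod_cast hn
  obtain ⟨T, hTfin, hT, hTnet⟩ := exists_finite_net_isCompressible n L (η := η) (by positivity)
  have := hTfin.to_subtype
  choose v l hv hl hquad using fun i : T => (hT i.1 i.2).2.2
  have hmean (i : T) : c₀ ≤ ∫ a, min |∑ j, l i j * ‖inner ℂ a (v i j)‖ ^ 2| B ∂μ := by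
    refine hc₀le.trans (hμ.le_integral_min (hv i) (hl i) hL hCSG hB ?_)
    have := hμ.subIsotropic i.1 (hT i.1 i.2).1
    rw [(hT i.1 i.2).2.1, one_pow, mul_one] at this
    simpa only [hquad] using this
  set A₁ : Set (Fin m → EuclideanSpace ℂ (Fin n)) :=
    {a | ∃ v ∈ N, m * (CI / 64) ≤ |∑ k, (‖inner ℂ (a k) v‖ ^ 2 - CI)|} with hA₁
  set A₂ : Set (Fin m → EuclideanSpace ℂ (Fin n)) :=
    {a | ∃ i, m * (c₀ / 2) ≤
      ∑ k, ((∫ a', min |∑ j, l i j * ‖inner ℂ a' (v i j)‖ ^ 2| B ∂μ) -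
        min |∑ j, l i j * ‖inner ℂ (a k) (v i j)‖ ^ 2| B)} with hA₂
  have hA₁m : MeasurableSet A₁ := by
    have : A₁ = ⋃ v ∈ N, {a | m * (CI / 64) ≤ |∑ k, (‖inner ℂ (a k) v‖ ^ 2 - CI)|} := by
      ext a; simp [hA₁]
    rw [this]
    exact N.measurableSet_biUnion fun v _ => measurableSet_le (by fun_prop) (by fun_prop)
  have hA₂m : MeasurableSet A₂ := by
    rw [hA₂, Set.ofPred_exists]
    exact .iUnion fun i => measurableSet_le (by fun_prop) (by fun_prop)
  have hexp {r : ℝ} (hr : m * κ ≤ r) : 2 * (N.card : ℝ) * Real.exp (-r) ≤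
      3 / 2 * Real.exp (-(κ / 2) * m) := by
    have h1 : (N.card : ℝ) ≤ 25 ^ n := by exact_mod_cast hNcard
    have h2 : (2 : ℝ) ≤ 2 ^ n := by
      simpa using pow_le_pow_right₀ (one_le_two (α := ℝ)) hn
    have h3 : (50 : ℝ) ≤ Real.exp 4 := by
      have := Real.exp_one_gt_d9
      calc (50 : ℝ) ≤ 2.7 ^ 4 := by norm_num
        _ ≤ Real.exp 1 ^ 4 := by gcongr; linarith
        _ = Real.exp 4 := by rw [← Real.exp_nat_mul]; norm_num
    have h4 : (50 : ℝ) ^ n ≤ Real.exp (4 * n) := by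
      rw [mul_comm, Real.exp_nat_mul]
      gcongr
    have h5 : 4 * (n : ℝ) ≤ κ / 2 * m := by
      rw [div_mul_eq_mul_div, div_le_iff₀ hκpos] at hm
      linarith
    calc 2 * (N.card : ℝ) * Real.exp (-r) ≤ 2 ^ n * 25 ^ n * Real.exp (-(m * κ)) := by gcongr
      _ ≤ Real.exp (4 * n) * Real.exp (-(m * κ)) := by
          rw [← mul_pow, show (2 : ℝ) * 25 = 50 by norm_num]
          gcongr
      _ ≤ Real.exp (κ / 2 * m) * Real.exp (-(m * κ)) := by gcongr
      _ = Real.exp (-(κ / 2) * m) := by rw [← Real.exp_add]; congr 1; ring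
      _ ≤ _ := by linarith [Real.exp_pos (-(κ / 2) * m)]
  have hP₁ : (Measure.pi fun _ : Fin m => μ) A₁ ≤
      ENNReal.ofReal (3 / 2 * Real.exp (-(κ / 2) * m)) := by
    refine (hμ.measure_deviation_le hCSG hCI hN1 htpos ht1 (CI / 64) m).trans
      (ENNReal.ofReal_le_ofReal (hexp ?_))
    gcongr
    have : t * δ ≤ t * (CI / 64) := by gcongr; exact min_le_left _ _
    linarith
  have hP₂ : (Measure.pi fun _ : Fin m => μ) A₂ ≤
      ENNReal.ofReal (3 / 2 * Real.exp (-(κ / 2) * m)) := by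
    have hs : 64 * L * (t / (64 * L)) = t := by field_simp
    refine (hμ.measure_truncated_deviation_le hCSG hCI hNe hN1 hN hv hl hL hB
      (s := t / (64 * L)) (by positivity) (by rwa [hs]) (by rwa [hs]) (m * (c₀ / 2)) m).trans
      (ENNReal.ofReal_le_ofReal (hexp ?_))
    rw [hs]
    have h1 : t * δ ≤ t * (c₀ / (128 * L)) := by gcongr; exact min_le_right _ _
    have h2 : t / (64 * L) * (m * (c₀ / 2)) = m * (t * (c₀ / (128 * L))) := by
      field_simp; ring
    rw [h2, ← mul_sub]
    gcongr
    linarith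
  refine ⟨(A₁ ∪ A₂)ᶜ, (hA₁m.union hA₂m).compl, ?_, fun a ha => ?_⟩
  · rw [compl_compl]
    refine (measure_union_le _ _).trans ((add_le_add hP₁ hP₂).trans (le_of_eq ?_))
    rw [← ENNReal.ofReal_add (by positivity) (by positivity)]
    congr 1; ring
  · simp only [Set.mem_compl_iff, Set.mem_union, not_or, hA₁, hA₂, Set.mem_ofPred_eq, not_exists,
      not_and, not_le] at ha
    obtain ⟨ha₁, ha₂⟩ := ha
    have hiso : NearIsotropic CI a := by
      intro x
      have := abs_weighted_le_of_net hN1 hN a (fun _ => 1) (-(m * CI)) (M := m * (CI / 64))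
        (fun v hv => by
          have := (ha₁ v hv).le
          rw [Finset.sum_sub_distrib] at this
          simpa [← sub_eq_add_neg] using this) x
      simp only [one_mul, neg_mul, ← sub_eq_add_neg] at this
      refine this.trans (le_of_eq ?_)
      ring
    refine ⟨hiso, fun X hX => ?_⟩
    obtain ⟨Y, hY, hXY⟩ := hTnet X hX
    have h1 : m * (c₀ / 2) ≤ ∑ k, |(quadForm Y (a k)).re| := by
      have h2 := (ha₂ ⟨Y, hY⟩).le
      have h3 : m * c₀ ≤ ∑ _k : Fin m,
          ∫ a', min |∑ j, l ⟨Y, hY⟩ j * ‖inner ℂ a' (v ⟨Y, hY⟩ j)‖ ^ 2| B ∂μ := by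
        rw [Finset.sum_const, Finset.card_univ, Fintype.card_fin, nsmul_eq_mul]
        gcongr
        exact hmean ⟨Y, hY⟩
      have h4 : ∑ k, min |∑ j, l ⟨Y, hY⟩ j * ‖inner ℂ (a k) (v ⟨Y, hY⟩ j)‖ ^ 2| B ≤
          ∑ k, |(quadForm Y (a k)).re| := by
        refine Finset.sum_le_sum fun k _ => (min_le_left _ _).trans (le_of_eq ?_)
        rw [← hquad ⟨Y, hY⟩]
      rw [Finset.sum_sub_distrib] at h2
      linarith
    have h2 : ∑ k, |(quadForm Y (a k)).re| - ∑ k, |(quadForm X (a k)).re| ≤ m * (c₀ / 4) := by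
      rw [← Finset.sum_sub_distrib]
      calc _ ≤ ∑ k, η * n * ‖a k‖ ^ 2 := by
            refine Finset.sum_le_sum fun k _ => ?_
            refine (abs_sub_abs_le_abs_sub _ _).trans ?_
            rw [← Complex.sub_re, ← quadForm_sub]
            refine (Complex.abs_re_le_norm _).trans (norm_quadForm_le (fun i j => ?_) _)
            rw [← neg_sub X Y, Matrix.neg_apply, norm_neg]
            exact hXY i j
        _ = η * n * ∑ k, ‖a k‖ ^ 2 := by rw [Finset.mul_sum]
        _ ≤ η * n * (m * (3 / 2 * CI) * n) := by gcongr; exact sum_norm_sq_le hiso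
        _ = _ := by rw [hη]; field_simp
    linarith

/-! ### Recovery on the good event -/

section Recovery

variable {n m : ℕ} {CI c : ℝ} {a : Fin m → EuclideanSpace ℂ (Fin n)}

theorem sum_re_quadForm_eq {X : Matrix (Fin n) (Fin n) ℂ} (hX : X.IsHermitian)
    (a : Fin m → EuclideanSpace ℂ (Fin n)) :
    ∑ k, (quadForm X (a k)).re =
      ∑ j, hX.eigenvalues j * ∑ k, ‖inner ℂ (a k) (hX.eigenvectorBasis j)‖ ^ 2 := by
  simp only [quadForm_eq_sum_eigenvalues hX, Complex.ofReal_re, Finset.mul_sum]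
  exact Finset.sum_comm

/-- The measurement map is bounded below on differences `Z - |x⟩⟨x|` with `Z ≥ 0`. -/
theorem le_sum_abs_quadForm_sub (hCI : 0 < CI) (ha : NearIsotropic CI a)
    (hc : ∀ X, IsCompressible 10 X → c * m ≤ ∑ k, |(quadForm X (a k)).re|)
    {Z : Matrix (Fin n) (Fin n) ℂ} (hZ : Z.PosSemidef) (x : EuclideanSpace ℂ (Fin n)) :
    min c (3 * CI) * m * hsNorm (Z - ketBra x) ≤
      ∑ k, |(quadForm (Z - ketBra x) (a k)).re| := by
  have hX : (Z - ketBra x).IsHermitian := hZ.isHermitian.sub (posSemidef_ketBra x).isHermitian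
  have hneg := sum_negPart_eigenvalues_le hZ hX
  set X := Z - ketBra x with hXdef
  set h := hsNorm X with hh
  have hm0 : (0 : ℝ) ≤ m := m.cast_nonneg
  rcases (hsNorm_nonneg X).eq_or_lt with h0 | hpos
  · rw [hh, ← h0, mul_zero]
    positivity
  rw [← hh] at hpos
  -- Beyond the threshold `10`, near isotropy leaves `10 / 2 - 2 = 3`, whence the constant `3 * CI`.
  rcases le_or_gt (∑ j, |hX.eigenvalues j|) (10 * h) with hle | hlt
  · have hcomp : IsCompressible 10 (h⁻¹ • X) := by
      refine ⟨?_, ?_, hX.eigenvectorBasis, fun j => h⁻¹ * hX.eigenvalues j,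
        hX.eigenvectorBasis.orthonormal.1, ?_, fun b => ?_⟩
      · exact hX.smul (IsSelfAdjoint.all _)
      · rw [hsNorm_smul, abs_of_pos (inv_pos.2 hpos), inv_mul_cancel₀ hpos.ne']
      · simp only [abs_mul, abs_of_pos (inv_pos.2 hpos), ← Finset.mul_sum]
        rw [inv_mul_le_iff₀ hpos]
        linarith
      · rw [quadForm_smul, quadForm_eq_sum_eigenvalues hX, ← Complex.ofReal_mul,
          Complex.ofReal_re, Finset.mul_sum]
        simp only [mul_assoc]
    have := hc _ hcomp
    simp only [quadForm_smul, Complex.re_ofReal_mul, abs_mul, abs_of_pos (inv_pos.2 hpos),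
      ← Finset.mul_sum] at this
    rw [le_inv_mul_iff₀ hpos] at this
    calc min c (3 * CI) * m * h ≤ c * m * h := by gcongr; exact min_le_left _ _
      _ ≤ _ := by linarith
  · have hterm (j : Fin n) :
        m * CI * (|hX.eigenvalues j| / 2 - 2 * max (-hX.eigenvalues j) 0) ≤
          hX.eigenvalues j * ∑ k, ‖inner ℂ (a k) (hX.eigenvectorBasis j)‖ ^ 2 := by
      have hiso := abs_le.1 (ha (hX.eigenvectorBasis j))
      rw [hX.eigenvectorBasis.orthonormal.1 j, one_pow, mul_one, mul_one] at hiso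
      rcases le_total 0 (hX.eigenvalues j) with hj | hj
      · rw [abs_of_nonneg hj, max_eq_right (by linarith)]
        nlinarith [mul_le_mul_of_nonneg_left hiso.1 hj]
      · rw [abs_of_nonpos hj, max_eq_left (by linarith)]
        nlinarith [mul_le_mul_of_nonneg_left hiso.2 (neg_nonneg.2 hj)]
    calc min c (3 * CI) * m * h ≤ 3 * CI * m * h := by gcongr; exact min_le_right _ _
      _ = m * CI * (10 * h / 2 - 2 * h) := by ring
      _ ≤ m * CI * ((∑ j, |hX.eigenvalues j|) / 2 - 2 * ∑ j, max (-hX.eigenvalues j) 0) := by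
          gcongr
      _ ≤ ∑ k, (quadForm X (a k)).re := by
          rw [sum_re_quadForm_eq hX, Finset.sum_div, Finset.mul_sum, ← Finset.sum_sub_distrib,
            Finset.mul_sum]
          exact Finset.sum_le_sum fun j _ => hterm j
      _ ≤ _ := Finset.sum_le_sum fun k _ => le_abs_self _

theorem le_sum_quadForm_of_posSemidef (ha : NearIsotropic CI a) {Z : Matrix (Fin n) (Fin n) ℂ}
    (hZ : Z.PosSemidef) : m * (CI / 2) * Z.trace.re ≤ ∑ k, (quadForm Z (a k)).re := by
  have h : Z.trace.re = ∑ j, hZ.isHermitian.eigenvalues j := by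
    rw [hZ.isHermitian.trace_eq_sum_eigenvalues, Complex.re_sum]
    simp
  rw [sum_re_quadForm_eq hZ.isHermitian, h, Finset.mul_sum]
  refine Finset.sum_le_sum fun j _ => ?_
  have hiso := (abs_le.1 (ha (hZ.isHermitian.eigenvectorBasis j))).1
  rw [hZ.isHermitian.eigenvectorBasis.orthonormal.1 j, one_pow, mul_one, mul_one] at hiso
  nlinarith [mul_le_mul_of_nonneg_left hiso (hZ.eigenvalues_nonneg j)]

theorem loss_eq {y : Fin m → ℝ} {Z : Matrix (Fin n) (Fin n) ℂ} (hZ : Z.IsHermitian) :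
    loss a y Z = ∑ k, |(quadForm Z (a k)).re - y k| := by
  refine Finset.sum_congr rfl fun k _ => ?_
  rw [trace_ketBra_mul, quadForm_eq_sum_eigenvalues hZ, Complex.ofReal_re, ← Complex.ofReal_sub,
    Complex.norm_real, Real.norm_eq_abs]

theorem exists_isMinimizer (hCI : 0 < CI) (hm : 0 < m) (ha : NearIsotropic CI a)
    (y : Fin m → ℝ) : ∃ X, IsMinimizer a y X := by
  set R := 4 * (∑ k, |y k|) / (m * CI) with hR
  have hm0 : (0 : ℝ) < m := by exact_mod_cast hm
  have hR0 : 0 ≤ R := by positivity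
  let S : Set (Matrix (Fin n) (Fin n) ℂ) := {Z | Z.PosSemidef ∧ Z.trace.re ≤ R}
  have hclosed : IsClosed S :=
    isClosed_setOf_posSemidef.inter (isClosed_le
      (Complex.continuous_re.comp continuous_id.matrix_trace) continuous_const)
  have hcompact : IsCompact S := by
    have hbox : IsCompact (Set.univ.pi fun _ : Fin n => Set.univ.pi fun _ : Fin n =>
        Metric.closedBall (0 : ℂ) R) :=
      isCompact_univ_pi fun _ => isCompact_univ_pi fun _ => isCompact_closedBall _ _
    refine IsCompact.of_isClosed_subset hbox hclosed fun Z hZ i _ j _ => ?_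
    rw [mem_closedBall_zero_iff]
    exact (norm_apply_le_hsNorm Z i j).trans ((hsNorm_le_trace hZ.1).trans hZ.2)
  have hzero : (0 : Matrix (Fin n) (Fin n) ℂ) ∈ S := ⟨.zero, by simpa using hR0⟩
  have hcont : Continuous (loss a y) := by unfold loss; fun_prop
  obtain ⟨X, hX, hmin⟩ := hcompact.exists_isMinOn ⟨0, hzero⟩ hcont.continuousOn
  refine ⟨X, hX.1, fun Z hZ => ?_⟩
  rcases le_or_gt Z.trace.re R with hle | hgt
  · exact hmin ⟨hZ, hle⟩
  · refine (hmin hzero).trans ?_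
    rw [loss_eq Matrix.isHermitian_zero, loss_eq hZ.isHermitian]
    have h1 := le_sum_quadForm_of_posSemidef ha hZ
    have h2 : m * (CI / 2) * R = 2 * ∑ k, |y k| := by rw [hR]; field_simp; ring
    have h3 : m * (CI / 2) * R ≤ m * (CI / 2) * Z.trace.re := by gcongr
    have h4 : ∑ k, (quadForm Z (a k)).re - ∑ k, |y k| ≤ ∑ k, |(quadForm Z (a k)).re - y k| := by
      rw [← Finset.sum_sub_distrib]
      refine Finset.sum_le_sum fun k _ => ?_
      linarith [le_abs_self ((quadForm Z (a k)).re - y k), le_abs_self (y k)]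
    have h5 : ∑ k, |(quadForm (0 : Matrix (Fin n) (Fin n) ℂ) (a k)).re - y k| = ∑ k, |y k| := by
      simp [quadForm]
    linarith

theorem hsNorm_sub_le_of_isMinimizer (hCI : 0 < CI) (hcpos : 0 < c) (hm : 0 < m)
    (ha : NearIsotropic CI a)
    (hc : ∀ X, IsCompressible 10 X → c * m ≤ ∑ k, |(quadForm X (a k)).re|)
    (x : EuclideanSpace ℂ (Fin n)) (ε : Fin m → ℝ) {X : Matrix (Fin n) (Fin n) ℂ}
    (hX : IsMinimizer a (measurements a x ε) X) :
    hsNorm (X - ketBra x) ≤ 2 / min c (3 * CI) * (∑ k, |ε k|) / m := by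
  have hm0 : (0 : ℝ) < m := by exact_mod_cast hm
  have hmin : 0 < min c (3 * CI) := lt_min hcpos (by positivity)
  have h1 := le_sum_abs_quadForm_sub hCI ha hc hX.1 x
  have h2 := hX.2 _ (posSemidef_ketBra x)
  rw [loss_eq hX.1.isHermitian, loss_eq (posSemidef_ketBra x).isHermitian] at h2
  simp only [quadForm_ketBra, Complex.ofReal_re, measurements, sub_add_cancel_left, abs_neg] at h2
  have h3 : ∑ k, |(quadForm (X - ketBra x) (a k)).re| ≤
      ∑ k, |(quadForm X (a k)).re - (‖inner ℂ (a k) x‖ ^ 2 + ε k)| + ∑ k, |ε k| := by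
    rw [← Finset.sum_add_distrib]
    refine Finset.sum_le_sum fun k _ => ?_
    rw [quadForm_sub, quadForm_ketBra, Complex.sub_re, Complex.ofReal_re]
    refine le_trans (le_of_eq ?_) (abs_add_le _ _)
    congr 1; ring
  rw [le_div_iff₀ hm0, div_mul_eq_mul_div, le_div_iff₀ hmin]
  linarith

end Recovery

/-- An event for the product measure pulls back to an event for independent samples, which need
only be almost everywhere measurable. -/
theorem exists_measurableSet_preimage {Ω E : Type*} [MeasurableSpace Ω] [MeasurableSpace E]
    {P : Measure Ω} [IsProbabilityMeasure P] {μ : Measure E} {m : ℕ} {α : Fin m → Ω → E}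
    (hα : ∀ k, HasLaw (α k) μ P) (hind : iIndepFun α P) {G : Set (Fin m → E)}
    (hG : MeasurableSet G) {r : ℝ} (hr : 0 ≤ r)
    (hGr : (Measure.pi fun _ : Fin m => μ) Gᶜ ≤ ENNReal.ofReal r) :
    ∃ A : Set Ω, MeasurableSet A ∧ 1 - r ≤ P.real A ∧ ∀ ω ∈ A, (fun k => α k ω) ∈ G := by
  have hmeas (k) : AEMeasurable (α k) P := (hα k).aemeasurable
  have hvec : AEMeasurable (fun ω k => α k ω) P := aemeasurable_pi_lambda _ hmeas
  have hmap := (iIndepFun_iff_map_fun_eq_pi_map hmeas).1 hind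
  simp only [(hα _).map_eq] at hmap
  have hnull : NullMeasurableSet ((fun ω k => α k ω) ⁻¹' G) P := hvec.nullMeasurableSet_preimage hG
  obtain ⟨A, hAG, hA, hAeq⟩ := hnull.exists_measurable_subset_ae_eq
  refine ⟨A, hA, ?_, fun ω hω => hAG hω⟩
  have h1 : P Aᶜ ≤ ENNReal.ofReal r := by
    refine le_of_eq_of_le ?_ hGr
    rw [← hmap, Measure.map_apply_of_aemeasurable hvec hG.compl, Set.preimage_compl]
    exact measure_congr hAeq.compl
  have h2 : P.real Aᶜ ≤ r := ENNReal.toReal_le_of_le_ofReal hr h1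
  rw [probReal_compl_eq_one_sub hA] at h2
  linarith

end PhaseLift

theorem mainTheorem1 (CI CSI CSG : ℝ) (hCI : 0 < CI) (hCSI : 0 < CSI) (hCSG : 0 < CSG) :
    ∃ C C' γ : ℝ, 0 < C ∧ 0 < C' ∧ 0 < γ ∧
      ∀ (n m : ℕ), C * (n : ℝ) ≤ (m : ℝ) →
      ∀ (μ : Measure (EuclideanSpace ℂ (Fin n))), PhaseLift.IsEnsemble μ CI CSI CSG →
      ∀ {Ω : Type*} [MeasurableSpace Ω] (P : Measure Ω) [IsProbabilityMeasure P]
        (α : Fin m → Ω → EuclideanSpace ℂ (Fin n)),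
        (∀ k, HasLaw (α k) μ P) → iIndepFun α P →
        ∃ E : Set Ω, MeasurableSet E ∧ 1 - 3 * Real.exp (-γ * (m : ℝ)) ≤ P.real E ∧
          ∀ ω ∈ E, ∀ (x : EuclideanSpace ℂ (Fin n)) (ε : Fin m → ℝ),
            (∃ X : Matrix (Fin n) (Fin n) ℂ,
              PhaseLift.IsMinimizer (fun k => α k ω)
                (PhaseLift.measurements (fun k => α k ω) x ε) X) ∧
            ∀ X : Matrix (Fin n) (Fin n) ℂ,
              PhaseLift.IsMinimizer (fun k => α k ω)
                (PhaseLift.measurements (fun k => α k ω) x ε) X →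
              PhaseLift.hsNorm (X - PhaseLift.ketBra x) ≤ C' * (∑ k, |ε k|) / (m : ℝ) := by
  obtain ⟨C, c, γ, hC, hc, hγ, H⟩ :=
    PhaseLift.exists_good_event hCI hCSI hCSG (by norm_num : (0 : ℝ) < 10)
  have hmin : 0 < min c (3 * CI) := lt_min hc (by positivity)
  refine ⟨C, 2 / min c (3 * CI), γ, hC, by positivity, hγ, ?_⟩
  intro n m hm μ hμ Ω _ P _ α hα hind
  rcases Nat.eq_zero_or_pos n with rfl | hn
  · refine ⟨Set.univ, .univ, ?_, fun ω _ x ε => ⟨⟨0, .zero, fun Z _ => ?_⟩, fun X _ => ?_⟩⟩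
    · rw [probReal_univ]
      linarith [Real.exp_pos (-γ * (m : ℝ))]
    · rw [Subsingleton.elim Z 0]
    · rw [show PhaseLift.hsNorm (X - PhaseLift.ketBra x) = 0 by simp [PhaseLift.hsNorm]]
      positivity
  · have hm0 : 0 < m := by
      have : 0 < C * (n : ℝ) := by positivity
      exact_mod_cast this.trans_le hm
    have : IsProbabilityMeasure μ := (hα ⟨0, hm0⟩).isProbabilityMeasure_iff.1 inferInstance
    obtain ⟨G, hG, hGP, hGood⟩ := H n m hn hm μ hμ
    obtain ⟨A, hA, hAP, hAG⟩ :=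
      PhaseLift.exists_measurableSet_preimage hα hind hG (by positivity) hGP
    refine ⟨A, hA, hAP, fun ω hω x ε => ?_⟩
    obtain ⟨hiso, hlow⟩ := hGood _ (hAG ω hω)
    exact ⟨PhaseLift.exists_isMinimizer hCI hm0 hiso _,
      fun X hX => PhaseLift.hsNorm_sub_le_of_isMinimizer hCI hc hm0 hiso hlow x ε hX⟩
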